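/- **Setting.** All random variables are complex valued on a probability space $(\Omega,\mathcal F,P)$ (real processes are a special case); $\operatorname{Cov}(U,V)=E[(U-EU)\overline{(V-EV)}]$. Let $\alpha>1$, $H>0$, and let $W(\alpha^k)=(W^0(\alpha^k),\dots,W^{q-1}(\alpha^k))$, $k\in\mathbb Z$, be a $q$-dimensional discrete-time wide-sense self-similar process of index $H$ with parameter space $S=\{\alpha^k:k\in\mathbb Z\}$. That is: whenever $a>0$ and $t,s,at,as\in S$, one has for all $i,j$: $E|W^j(t)|^2<\infty$, $E[W^j(at)]=a^HE[W^j(t)]$, $E[W^j(at)\overline{W^j(as)}]=a^{2H}E[W^j(t)\overline{W^j(s)}]$, and $\operatorname{Cov}(W^i(at),W^j(as))=a^{2H}\operatorname{Cov}(W^i(t),W^j(s))$. A *random orthogonal measure* $\varphi$ is a mean-square countably additive $L^2(P)$-valued function on the Borel sets of $\mathbb R$ with $E[\varphi(A)\overline{\varphi(B)}]=0$ for disjoint $A,B$. For $f$ square integrable with respect to the measure $A\mapsto E|\varphi(A)|^2$, $\int f\,d\varphi$ is the mean-square limit of $\sum_c c\,\varphi(s_n=c)$ over simple functions $s_n\to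 f$ in $L^2$ of that measure. **Theorem 3.1.** There are random orthogonal measures $\varphi_0,\dots,\varphi_{q-1}$ carried by $[0,2\pi)$ and complex (finite, $\sigma$-additive) Borel measures $D^H_{jr}$ such that the following holds. (i) For all $j$ and $k\in\mathbb Z$, $$W^j(\alpha^k)=\alpha^{kH}\int_0^{2\pi}e^{i\omega k}\,d\varphi_j(\omega)\quad\text{a.s.},$$ and $E[\varphi_j(A)\overline{\varphi_r(B)}]=D^H_{jr}(A\cap B)$ for all $j,r$ and Borel $A,B$. In particular this is $0$ for disjoint $A,B$. (ii) Let $Q^H_{jr}(\alpha^n)=E[W^j(\alpha^n)\overline{W^r(1)}]$, which is the covariance of $W^j(\alpha^n)$ and $W^r(1)$ when $W$ has mean zero. Then for all $j,r$ the spectral distribution $D^H_{jr}$ has density $$d^H_{jr}(\omega)=\frac1{2\pi}\sum_{n=-\infty}^{\infty}\alpha^{-nH}e^{-i\omega n}Q^H_{jr}(\alpha^n)$$ in the following sense. Let $S_N(\omega)$ be the partial sum over $|n|\le N$ of the right-hand side. * (Integrated form, always.) If $0\le a\le b\le 2\pi$ and $D^H_{jr}(\{a\})=D^H_{jr}(\{b\})=0$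 (and also $D^H_{jr}(\{0\})=0$ if $b=2\pi$), then $D^H_{jr}((a,b))=\lim_{N\to\infty}\int_a^bS_N(\omega)\,d\omega$. * (If the density exists.) If $D^H_{jr}$ has an integrable density $d$ on $[0,2\pi)$, then $\int_0^{2\pi}\bigl|\frac1{N+1}\sum_{M=0}^NS_M(\omega)-d(\omega)\bigr|d\omega\to0$ as $N\to\infty$, and for almost every $\omega\in[0,2\pi)$ at which $S_N(\omega)$ converges, the limit is $d(\omega)$. * (If the series converges absolutely.) If $\sum_n\alpha^{-nH}|Q^H_{jr}(\alpha^n)|<\infty$, then $D^H_{jr}$ has a density on $[0,2\pi)$, and it is given at every $\omega$ by the sum of the series. Without assuming that $W$ has mean zero, there are moreover complex Borel measures $C_{jr}$ with $\operatorname{Cov}(\varphi_j(A),\varphi_r(B))=C_{jr}(A\cap B)$ for all Borel $A,B$, and (ii) holds with $C_{jr}$ in place of $D^H_{jr}$ and $\operatorname{Cov}(W^j(\alpha^n),W^r(1))$ in place of $Q^H_{jr}(\alpha^n)$. -/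

import Mathlib

open MeasureTheory Filter Topology
open scoped ENNReal ComplexConjugate

noncomputable section

/-! ### Second-order quantities of complex random variables -/

/-- The (uncentered) mixed second moment `E[U \bar V]`. -/
def mixedMoment {Ω : Type*} [MeasurableSpace Ω] (μ : Measure Ω) (U V : Ω → ℂ) : ℂ :=
  ∫ x, U x * conj (V x) ∂μ

/-- The covariance `Cov(U, V) = E[(U - E U) \overline{(V - E V)}]`. -/
def complexCov {Ω : Type*} [MeasurableSpace Ω] (μ : Measure Ω) (U V : Ω → ℂ) : ℂ :=
  mixedMoment μ (fun x => U x - ∫ y, U y ∂μ) (fun x => V x - ∫ y, V y ∂μ)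

/-! ### Wide-sense self-similar processes in discrete time

A process is given at all real times, but only its values on the parameter space `S` matter. -/

/-- Wide-sense self-similarity of index `H` of a complex process `X` with parameter space `S`. -/
structure IsWideSenseSelfSimilar {Ω : Type*} [MeasurableSpace Ω] (μ : Measure Ω)
    (S : Set ℝ) (H : ℝ) (X : ℝ → Ω → ℂ) : Prop where
  memLp : ∀ t ∈ S, MemLp (X t) 2 μ
  mean : ∀ a > 0, ∀ t ∈ S, a * t ∈ S →
    ∫ x, X (a * t) x ∂μ = ((a ^ H : ℝ) : ℂ) * ∫ x, X t x ∂μ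
  moment : ∀ a > 0, ∀ t ∈ S, ∀ s ∈ S, a * t ∈ S → a * s ∈ S →
    mixedMoment μ (X (a * t)) (X (a * s)) = ((a ^ (2 * H) : ℝ) : ℂ) * mixedMoment μ (X t) (X s)

/-- `q`-dimensional wide-sense self-similarity of index `H` with parameter space `S`: every
component is self-similar, and any two components have self-similar cross-covariance. -/
structure IsMultiSelfSimilar {Ω : Type*} [MeasurableSpace Ω] (μ : Measure Ω) {q : ℕ}
    (S : Set ℝ) (H : ℝ) (U : Fin q → ℝ → Ω → ℂ) : Prop where
  component : ∀ j, IsWideSenseSelfSimilar μ S H (U j)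
  cross : ∀ i j, ∀ a > 0, ∀ t ∈ S, ∀ s ∈ S, a * t ∈ S → a * s ∈ S →
    complexCov μ (U i (a * t)) (U j (a * s)) =
      ((a ^ (2 * H) : ℝ) : ℂ) * complexCov μ (U i t) (U j s)

/-! ### Orthogonal random measures and integrals against them -/

/-- A random orthogonal measure on the line: a set function on Borel sets with values in
`L²(μ)`, countably additive in mean square, with orthogonal values on disjoint sets. -/
structure OrthogonalRandomMeasure {Ω : Type*} [MeasurableSpace Ω] (μ : Measure Ω) where
  toVectorMeasure : VectorMeasure ℝ (Lp ℂ 2 μ)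
  orthogonal : ∀ A B : Set ℝ, MeasurableSet A → MeasurableSet B → Disjoint A B →
    mixedMoment μ (toVectorMeasure A) (toVectorMeasure B) = 0

namespace OrthogonalRandomMeasure

variable {Ω : Type*} [MeasurableSpace Ω] {μ : Measure Ω}

instance : CoeFun (OrthogonalRandomMeasure μ) (fun _ => Set ℝ → Lp ℂ 2 μ) :=
  ⟨fun φ => φ.toVectorMeasure⟩

theorem inner_eq_mixedMoment (U V : Lp ℂ 2 μ) : inner ℂ V U = mixedMoment μ U V := by
  rw [L2.inner_def]; rfl

theorem hasSum_norm_sq (φ : OrthogonalRandomMeasure μ) (f : ℕ → Set ℝ)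
    (hf : ∀ i, MeasurableSet (f i)) (hd : Pairwise (Function.onFun Disjoint f)) :
    HasSum (fun i => ‖φ (f i)‖ ^ 2) (‖φ (⋃ i, f i)‖ ^ 2) := by
  have h1 := φ.toVectorMeasure.m_iUnion hf hd
  have h2 := h1.mapL (innerSL ℂ (φ (⋃ i, f i)))
  have key : ∀ i, inner ℂ (φ (⋃ i, f i)) (φ (f i)) = ((‖φ (f i)‖ ^ 2 : ℝ) : ℂ) := by
    intro i
    have hsub : f i ⊆ ⋃ i, f i := Set.subset_iUnion f i
    have hsplit := φ.toVectorMeasure.of_add_of_sdiff (hf i) (MeasurableSet.iUnion hf) hsub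
    have ho := φ.orthogonal (f i) ((⋃ i, f i) \ f i) (hf i)
      ((MeasurableSet.iUnion hf).diff (hf i)) Set.disjoint_sdiff_right
    rw [← hsplit, inner_add_left, inner_eq_mixedMoment (φ (f i)) (φ ((⋃ i, f i) \ f i)), ho,
      add_zero, inner_self_eq_norm_sq_to_K]
    push_cast; rfl
  have h3 := h2.mapL (RCLike.reCLM : ℂ →L[ℝ] ℝ)
  simp only [innerSL_apply_apply, key, RCLike.reCLM_apply, inner_self_eq_norm_sq] at h3
  simpa [← Complex.ofReal_pow] using h3

/-- The structure (control) measure `A ↦ E|φ(A)|²`. -/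
def controlMeasure (φ : OrthogonalRandomMeasure μ) : Measure ℝ :=
  Measure.ofMeasurable (fun A _ => ENNReal.ofReal (‖φ A‖ ^ 2)) (by simp) (by
    intro f hf hd
    have h := φ.hasSum_norm_sq f hf hd
    rw [← h.tsum_eq]
    exact ENNReal.ofReal_tsum_of_nonneg (fun i => by positivity) h.summable)

theorem controlMeasure_apply (φ : OrthogonalRandomMeasure μ) {A : Set ℝ} (hA : MeasurableSet A) :
    φ.controlMeasure A = ENNReal.ofReal (‖φ A‖ ^ 2) :=
  Measure.ofMeasurable_apply A hA

/-- `∫ s dφ` for a simple function `s`. -/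
def simpleIntegral (φ : OrthogonalRandomMeasure μ) (s : SimpleFunc ℝ ℂ) : Lp ℂ 2 μ :=
  ∑ c ∈ s.range, c • φ (s ⁻¹' {c})

/-- `φ.HasIntegral f I` says that `f` is square integrable for the structure measure of `φ` and
that `I = ∫ f dφ` in mean square: for all simple functions `sₙ → f` in `L²` of the structure
measure, `∫ sₙ dφ → I` in `L²(μ)`.  (Simple functions are dense there, so `I` is unique.) -/
def HasIntegral (φ : OrthogonalRandomMeasure μ) (f : ℝ → ℂ) (I : Lp ℂ 2 μ) : Prop :=
  MemLp f 2 φ.controlMeasure ∧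
    ∀ s : ℕ → SimpleFunc ℝ ℂ,
      Tendsto (fun n => eLpNorm (fun ω => s n ω - f ω) 2 φ.controlMeasure) atTop (𝓝 0) →
      Tendsto (fun n => φ.simpleIntegral (s n)) atTop (𝓝 I)

end OrthogonalRandomMeasure

/-! ### Spectral densities -/

/-- `d` is the density on `[0, 2π)` of the complex spectral distribution `D`. -/
def IsSpectralDensity (D : ComplexMeasure ℝ) (d : ℝ → ℂ) : Prop :=
  IntegrableOn d (Set.Ico 0 (2 * Real.pi)) ∧
    ∀ A : Set ℝ, MeasurableSet A → D A = ∫ ω in A ∩ Set.Ico 0 (2 * Real.pi), d ω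

/-- The `n`-th term `(1/2π) α^{-nH} e^{-iωn} Q(αⁿ)` of the spectral density series. -/
def spectralTerm (α H : ℝ) (Q : ℝ → ℂ) (n : ℤ) (ω : ℝ) : ℂ :=
  (1 / (2 * Real.pi) : ℂ) * ((α ^ (-(n : ℝ) * H) : ℝ) : ℂ) *
    Complex.exp (-(Complex.I * ω * n)) * Q (α ^ n)

/-- The symmetric partial sum over `|n| ≤ N` of the spectral density series. -/
def spectralPartialSum (α H : ℝ) (Q : ℝ → ℂ) (N : ℕ) (ω : ℝ) : ℂ :=
  ∑ n ∈ Finset.Icc (-(N : ℤ)) N, spectralTerm α H Q n ω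

/-- The arithmetic mean of the symmetric partial sums of order `0, …, N`. -/
def spectralCesaroSum (α H : ℝ) (Q : ℝ → ℂ) (N : ℕ) (ω : ℝ) : ℂ :=
  (1 / ((N : ℂ) + 1)) * ∑ M ∈ Finset.range (N + 1), spectralPartialSum α H Q M ω

/-- "`D` has the spectral density `(1/2π) ∑ₙ α^{-nH} e^{-iωn} Q(αⁿ)`."  A spectral distribution
need not be absolutely continuous and the series need not converge pointwise, so the formula
means the following.
* `integrated`: with no assumption, the formula holds in integrated form, on every interval
  whose end points carry no mass (`0` and `2π` being the same point of the circle).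
* `of_density`: if `D` has a density `d`, then `d` is the sum of the series, by arithmetic means
  in `L¹`, and pointwise at almost every frequency at which the series converges.
* `of_summable`: if the series converges absolutely, then `D` has a density and its sum is one. -/
structure HasSpectralDensitySeries (α H : ℝ) (Q : ℝ → ℂ) (D : ComplexMeasure ℝ) : Prop where
  integrated : ∀ a b : ℝ, 0 ≤ a → a ≤ b → b ≤ 2 * Real.pi → D {a} = 0 → D {b} = 0 →
    (b = 2 * Real.pi → D {0} = 0) →
    Tendsto (fun N : ℕ => ∫ ω in a..b, spectralPartialSum α H Q N ω) atTop
      (𝓝 (D (Set.Ioo a b)))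
  of_density : ∀ d : ℝ → ℂ, IsSpectralDensity D d →
    Tendsto (fun N : ℕ => ∫ ω in Set.Ico 0 (2 * Real.pi), ‖spectralCesaroSum α H Q N ω - d ω‖)
      atTop (𝓝 0) ∧
    ∀ᵐ ω ∂volume.restrict (Set.Ico 0 (2 * Real.pi)), ∀ s : ℂ,
      Tendsto (fun N : ℕ => spectralPartialSum α H Q N ω) atTop (𝓝 s) → d ω = s
  of_summable : Summable (fun n : ℤ => α ^ (-(n : ℝ) * H) * ‖Q (α ^ n)‖) →
    (∀ ω : ℝ, Summable fun n : ℤ => spectralTerm α H Q n ω) ∧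
    IsSpectralDensity D (fun ω => ∑' n : ℤ, spectralTerm α H Q n ω)

end

/-!
Renormalising, `Y_j(k) = α^{-kH} W^j(α^k)` is a family of jointly stationary sequences in `L²(μ)`,
so the theorem is the spectral theory of stationary sequences on the circle, here realised on
`[0, 2π)`.

*Representation.* The Cesàro means of the Fourier series of the covariances of one sequence are
nonnegative; a weak limit point of them is the spectral measure `ν_j` (Herglotz' theorem,
`exists_spectralMeasure`). Then `e^{iωk} ↦ Y_j(k)` preserves inner products and extends to an
isometry `V_j` of `L²(ν_j)` into `L²(μ)` (`exists_spectralRepresentation`). The random measure is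
`φ_j(A) = V_j 1_A`, with control measure `ν_j`, and `∫ f dφ_j = V_j f`.

*Cross spectral measures.* The adjoint of `V_j` maps `Y_r(0)` to a function whose conjugate is the
density `h` of `D_{jr}` relative to `ν_j`. By stationarity `E[V_j f · conj (Y_r m)]` is the integral
of `f h e^{-iωm}`, and approximating `1_B` by trigonometric polynomials simultaneously in `L²(ν_j)`
and `L²(ν_r)` gives `E[φ_j(A) conj φ_r(B)] = D_{jr}(A ∩ B)`
(`SpectralRepresentation.inner_toVectorMeasure`). For the covariances, the sequences are projected
off the constants; the projection intertwines the two representations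
(`SpectralRepresentation.map_toVectorMeasure`), so `C_{jr}` is the cross spectral measure of the
centered sequences.

*Density series.* All three forms concern a complex measure `h dν` with given Fourier coefficients
(`hasSpectralDensitySeries_withDensity`). The integrated form is dominated convergence, as the
Fourier series of the indicator function of an interval converges boundedly: its partial sums are
differences of partial sums of the sawtooth series. If there is an integrable density, the Cesàro
means converge to it in `L¹` because the Fejér kernel is nonnegative of integral one. If the series
converges absolutely, its sum has the same Fourier coefficients as the measure, and these determine
the measure.
-/

/-! ### Characters and trigonometric polynomials -/

/-- The character `ω ↦ e^{iωk}` of the line, of period `2π`. -/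
noncomputable def trigChar (k : ℤ) (ω : ℝ) : ℂ := Complex.exp (Complex.I * ω * k)

theorem continuous_trigChar (k : ℤ) : Continuous (trigChar k) := by
  unfold trigChar; fun_prop

theorem norm_trigChar (k : ℤ) (ω : ℝ) : ‖trigChar k ω‖ = 1 := by
  have : Complex.I * ω * k = ((ω * k : ℝ) : ℂ) * Complex.I := by push_cast; ring
  rw [trigChar, this, Complex.norm_exp_ofReal_mul_I]

theorem trigChar_add (k l : ℤ) (ω : ℝ) : trigChar (k + l) ω = trigChar k ω * trigChar l ω := by
  rw [trigChar, trigChar, trigChar, ← Complex.exp_add]; push_cast; ring_nf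

theorem trigChar_neg (k : ℤ) (ω : ℝ) : trigChar (-k) ω = conj (trigChar k ω) := by
  rw [trigChar, trigChar, ← Complex.exp_conj]; simp

theorem trigChar_sub (k l : ℤ) (ω : ℝ) :
    trigChar (k - l) ω = trigChar k ω * conj (trigChar l ω) := by
  rw [sub_eq_add_neg, trigChar_add, trigChar_neg]

@[simp] theorem trigChar_zero (ω : ℝ) : trigChar 0 ω = 1 := by simp [trigChar]

theorem memLp_trigChar (p : ℝ≥0∞) (m : Measure ℝ) [IsFiniteMeasure m] (k : ℤ) :
    MemLp (trigChar k) p m :=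
  MemLp.of_bound (continuous_trigChar k).aestronglyMeasurable 1
    (.of_forall fun ω => (norm_trigChar k ω).le)

theorem integrable_trigChar (m : Measure ℝ) [IsFiniteMeasure m] (k : ℤ) :
    Integrable (trigChar k) m :=
  memLp_one_iff_integrable.1 (memLp_trigChar 1 m k)

theorem memLp_conj {X : Type*} [MeasurableSpace X] {m : Measure X} {p : ℝ≥0∞} {f : X → ℂ}
    (hf : MemLp f p m) : MemLp (fun x => conj (f x)) p m :=
  hf.of_le (Complex.continuous_conj.comp_aestronglyMeasurable hf.1) (.of_forall fun x => by simp)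

/-- The character `ω ↦ e^{iωk}` as an element of `Lᵖ(m)`. -/
noncomputable def trigCharLp (p : ℝ≥0∞) (m : Measure ℝ) [IsFiniteMeasure m] (k : ℤ) : Lp ℂ p m :=
  (memLp_trigChar p m k).toLp

theorem coeFn_trigCharLp (p : ℝ≥0∞) (m : Measure ℝ) [IsFiniteMeasure m] (k : ℤ) :
    trigCharLp p m k =ᵐ[m] trigChar k := MemLp.coeFn_toLp _

instance fact_two_pi_pos : Fact (0 < 2 * Real.pi) := ⟨Real.two_pi_pos⟩

/-- The representative in `[0, 2π)` of a point of the circle `ℝ / 2πℤ`. -/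
noncomputable def circleRep (x : AddCircle (2 * Real.pi)) : ℝ :=
  AddCircle.equivIco (2 * Real.pi) 0 x

theorem circleRep_mem (x : AddCircle (2 * Real.pi)) : circleRep x ∈ Set.Ico 0 (2 * Real.pi) := by
  simpa [circleRep] using (AddCircle.equivIco (2 * Real.pi) 0 x).2

theorem coe_circleRep (x : AddCircle (2 * Real.pi)) : (circleRep x : AddCircle (2 * Real.pi)) = x :=
  AddCircle.coe_equivIco

theorem circleRep_coe {ω : ℝ} (h : ω ∈ Set.Ico 0 (2 * Real.pi)) :
    circleRep (ω : AddCircle (2 * Real.pi)) = ω := by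
  rw [circleRep, AddCircle.equivIco_coe_of_mem]; simpa using h

theorem measurable_circleRep : Measurable circleRep :=
  measurable_subtype_coe.comp (AddCircle.measurableEquivIco (2 * Real.pi) 0).measurable

theorem fourier_coe_eq_trigChar (k : ℤ) (ω : ℝ) :
    fourier k (ω : AddCircle (2 * Real.pi)) = trigChar k ω := by
  rw [fourier_coe_apply, trigChar]
  congr 1
  have : (Real.pi : ℂ) ≠ 0 := by exact_mod_cast Real.pi_ne_zero
  push_cast; field_simp

theorem measurePreserving_coe_circle (m : Measure ℝ) :
    MeasurePreserving ((↑) : ℝ → AddCircle (2 * Real.pi)) m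
      (m.map ((↑) : ℝ → AddCircle (2 * Real.pi))) :=
  ⟨AddCircle.measurable_mk', rfl⟩

theorem measurePreserving_circleRep {m : Measure ℝ} (hm : m (Set.Ico 0 (2 * Real.pi))ᶜ = 0) :
    MeasurePreserving circleRep (m.map ((↑) : ℝ → AddCircle (2 * Real.pi))) m := by
  refine ⟨measurable_circleRep, ?_⟩
  rw [Measure.map_map measurable_circleRep AddCircle.measurable_mk']
  have : circleRep ∘ ((↑) : ℝ → AddCircle (2 * Real.pi)) =ᵐ[m] id := by
    have : ∀ᵐ ω ∂m, ω ∈ Set.Ico 0 (2 * Real.pi) := by rwa [ae_iff]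
    filter_upwards [this] with ω h using circleRep_coe h
  rw [Measure.map_congr this, Measure.map_id]

/-- Trigonometric polynomials are dense in `Lᵖ` of any finite measure carried by `[0, 2π)`, since
such a measure is a measure on the circle. -/
theorem span_trigCharLp_closure_eq_top {p : ℝ≥0∞} [Fact (1 ≤ p)] (hp : p ≠ ∞) {m : Measure ℝ}
    [IsFiniteMeasure m] (hm : m (Set.Ico 0 (2 * Real.pi))ᶜ = 0) :
    (Submodule.span ℂ (Set.range (trigCharLp p m))).topologicalClosure = ⊤ := by
  have hc := measurePreserving_coe_circle m
  set m' := m.map ((↑) : ℝ → AddCircle (2 * Real.pi)) with hm'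
  have h1 := (ContinuousMap.toLp_denseRange ℂ m' ℂ hp).topologicalClosure_map_submodule
    (span_fourier_closure_eq_top (T := 2 * Real.pi))
  have hsurj : Function.Surjective
      (Lp.compMeasurePreservingₗᵢ ℂ _ hc : Lp ℂ p m' →ₗᵢ[ℂ] Lp ℂ p m).toContinuousLinearMap := by
    intro g
    refine ⟨Lp.compMeasurePreservingₗᵢ ℂ _ (measurePreserving_circleRep hm) g, ?_⟩
    refine Lp.ext ?_
    have e1 := Lp.coeFn_compMeasurePreserving
      (Lp.compMeasurePreserving _ (measurePreserving_circleRep hm) g) hc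
    have e2 := hc.quasiMeasurePreserving.ae_eq_comp
      (Lp.coeFn_compMeasurePreserving g (measurePreserving_circleRep hm))
    have h : ∀ᵐ ω ∂m, ω ∈ Set.Ico 0 (2 * Real.pi) := by rwa [ae_iff]
    filter_upwards [e1, e2, h] with ω e1 e2 h
    refine e1.trans (e2.trans ?_)
    simp [circleRep_coe h]
  have h2 := hsurj.denseRange.topologicalClosure_map_submodule h1
  rw [Submodule.map_span, Submodule.map_span, ← Set.range_comp, ← Set.range_comp] at h2
  suffices hr : trigCharLp p m =
      (Lp.compMeasurePreservingₗᵢ ℂ _ hc : Lp ℂ p m' →ₗᵢ[ℂ] Lp ℂ p m).toContinuousLinearMap ∘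
        ContinuousMap.toLp p m' ℂ ∘ fourier (T := 2 * Real.pi) by
    rw [hr]; exact h2
  funext k
  refine Lp.ext ?_
  have e1 := Lp.coeFn_compMeasurePreserving
      (ContinuousMap.toLp p m' ℂ (fourier (T := 2 * Real.pi) k)) hc
  have e2 := hc.quasiMeasurePreserving.ae_eq_comp
      (ContinuousMap.coeFn_toLp (p := p) (𝕜 := ℂ) m' (fourier (T := 2 * Real.pi) k))
  filter_upwards [e1, e2, coeFn_trigCharLp p m k] with ω e1 e2 e3
  rw [e3]
  refine (e1.trans (e2.trans ?_)).symm
  exact fourier_coe_eq_trigChar k ω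

/-- The restriction map `Lᵖ(m') → Lᵖ(m)` for `m ≤ m'`. -/
noncomputable def lpOfMeasureLE (p : ℝ≥0∞) [Fact (1 ≤ p)] {m m' : Measure ℝ} (h : m ≤ m') :
    Lp ℂ p m' →L[ℂ] Lp ℂ p m :=
  LinearMap.mkContinuous
    { toFun := fun f => ((Lp.memLp f).mono_measure h).toLp
      map_add' := fun f g => by
        rw [← MemLp.toLp_add, MemLp.toLp_eq_toLp_iff]
        exact (Measure.absolutelyContinuous_of_le h).ae_le (Lp.coeFn_add f g)
      map_smul' := fun c f => by
        rw [RingHom.id_apply, ← MemLp.toLp_const_smul, MemLp.toLp_eq_toLp_iff]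
        exact (Measure.absolutelyContinuous_of_le h).ae_le (Lp.coeFn_smul c f) }
    1 (fun f => by
      rw [one_mul, LinearMap.coe_mk, AddHom.coe_mk, Lp.norm_toLp, Lp.norm_def]
      exact ENNReal.toReal_mono (Lp.eLpNorm_ne_top f) (eLpNorm_mono_measure _ h))

theorem lpOfMeasureLE_toLp (p : ℝ≥0∞) [Fact (1 ≤ p)] {m m' : Measure ℝ} (h : m ≤ m') {g : ℝ → ℂ}
    (hg : MemLp g p m') : lpOfMeasureLE p h hg.toLp = (hg.mono_measure h).toLp := by
  change MemLp.toLp _ ((Lp.memLp hg.toLp).mono_measure h) = _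
  rw [MemLp.toLp_eq_toLp_iff]
  exact (Measure.absolutelyContinuous_of_le h).ae_le hg.coeFn_toLp

/-- Continuous linear maps on two `Lᵖ` spaces over `[0, 2π)` that agree on the characters agree
on every function that belongs to both spaces. -/
theorem map_toLp_eq_of_trigCharLp {p : ℝ≥0∞} [Fact (1 ≤ p)] (hp : p ≠ ∞) {m m' : Measure ℝ}
    [IsFiniteMeasure m] [IsFiniteMeasure m'] (hm : m (Set.Ico 0 (2 * Real.pi))ᶜ = 0)
    (hm' : m' (Set.Ico 0 (2 * Real.pi))ᶜ = 0)
    {G : Type*} [NormedAddCommGroup G] [NormedSpace ℂ G]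
    (F : Lp ℂ p m →L[ℂ] G) (F' : Lp ℂ p m' →L[ℂ] G)
    (h : ∀ k, F (trigCharLp p m k) = F' (trigCharLp p m' k)) {g : ℝ → ℂ}
    (hg : MemLp g p (m + m')) :
    F hg.left_of_add_measure.toLp = F' hg.right_of_add_measure.toLp := by
  have hle : m ≤ m + m' := Measure.le_add_right le_rfl
  have hle' : m' ≤ m + m' := Measure.le_add_left le_rfl
  have hsum : (m + m') (Set.Ico 0 (2 * Real.pi))ᶜ = 0 := by simp [hm, hm']
  have key : F.comp (lpOfMeasureLE p hle) = F'.comp (lpOfMeasureLE p hle') := by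
    refine ContinuousLinearMap.ext_on ?_ (s := Set.range (trigCharLp p (m + m'))) ?_
    · rw [Submodule.dense_iff_topologicalClosure_eq_top]
      exact span_trigCharLp_closure_eq_top hp hsum
    · rintro _ ⟨k, rfl⟩
      simp only [trigCharLp, ContinuousLinearMap.comp_apply, lpOfMeasureLE_toLp]
      exact h k
  have := congrArg (fun L => L hg.toLp) key
  simpa only [ContinuousLinearMap.comp_apply, lpOfMeasureLE_toLp] using this

theorem integral_Ico_trigChar (k : ℤ) :
    ∫ ω in Set.Ico 0 (2 * Real.pi), trigChar k ω = if k = 0 then (2 * Real.pi : ℂ) else 0 := by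
  rw [integral_Ico_eq_integral_Ioc, ← intervalIntegral.integral_of_le Real.two_pi_pos.le]
  split_ifs with hk
  · subst hk; simp
  · have hk' : Complex.I * (k : ℂ) ≠ 0 := mul_ne_zero Complex.I_ne_zero (by exact_mod_cast hk)
    have : trigChar k = fun ω : ℝ => Complex.exp (Complex.I * k * ω) := by
      funext ω; rw [trigChar]; ring_nf
    rw [this, integral_exp_mul_complex hk']
    have : Complex.exp (Complex.I * k * ((2 * Real.pi : ℝ) : ℂ)) = 1 := by
      rw [← Complex.exp_int_mul_two_pi_mul_I k]; push_cast; ring_nf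
    rw [this]; simp

/-! ### Fourier sums and stationary sequences -/

/-- The symmetric partial sum `(1/2π) ∑_{|n| ≤ N} R(n) e^{-iωn}` of the Fourier series with
coefficients `R`. -/
noncomputable def fourierPartialSum (R : ℤ → ℂ) (N : ℕ) (ω : ℝ) : ℂ :=
  ∑ n ∈ Finset.Icc (-(N : ℤ)) N, (1 / (2 * Real.pi) : ℂ) * R n * trigChar (-n) ω

/-- The arithmetic mean of the symmetric partial sums of order `0, …, N`. -/
noncomputable def fourierCesaroSum (R : ℤ → ℂ) (N : ℕ) (ω : ℝ) : ℂ :=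
  (1 / ((N : ℂ) + 1)) * ∑ M ∈ Finset.range (N + 1), fourierPartialSum R M ω

theorem continuous_fourierPartialSum (R : ℤ → ℂ) (N : ℕ) : Continuous (fourierPartialSum R N) :=
  continuous_finsetSum _ fun n _ => continuous_const.mul (continuous_trigChar (-n))

theorem continuous_fourierCesaroSum (R : ℤ → ℂ) (N : ℕ) : Continuous (fourierCesaroSum R N) :=
  continuous_const.mul (continuous_finsetSum _ fun M _ => continuous_fourierPartialSum R M)

theorem sum_Icc_neg_eq (c : ℤ → ℂ) (N : ℕ) :
    ∑ k ∈ Finset.Icc (-(N : ℤ)) N, c k =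
      c 0 + ∑ n ∈ Finset.range N, (c (n - N) + c (N - n)) := by
  induction N with
  | zero => simp
  | succ N ih =>
    have h : Finset.Icc (-((N + 1 : ℕ) : ℤ)) ((N + 1 : ℕ) : ℤ) =
        insert (-((N : ℤ) + 1)) (insert ((N : ℤ) + 1) (Finset.Icc (-(N : ℤ)) N)) := by
      ext k; simp only [Finset.mem_Icc, Finset.mem_insert]; push_cast; omega
    rw [h, Finset.sum_insert (by simp; omega), Finset.sum_insert (by simp), ih,
      Finset.sum_range_succ']
    push_cast
    simp only [add_sub_add_right_eq_sub, zero_sub, sub_zero]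
    ring

/-- Summing the symmetric sums of orders `0, …, N - 1` sums over the differences of a square. -/
theorem sum_range_sum_Icc_neg (c : ℤ → ℂ) (N : ℕ) :
    ∑ M ∈ Finset.range N, ∑ k ∈ Finset.Icc (-(M : ℤ)) M, c k =
      ∑ m ∈ Finset.range N, ∑ n ∈ Finset.range N, c ((n : ℤ) - m) := by
  induction N with
  | zero => simp
  | succ N ih =>
    rw [Finset.sum_range_succ, ih, sum_Icc_neg_eq, Finset.sum_range_succ]
    simp only [Finset.sum_range_succ, Finset.sum_add_distrib, sub_self]
    ring

section Stationary

variable {E : Type*} [NormedAddCommGroup E] [InnerProductSpace ℂ E]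

/-- Two Hilbert space valued sequences are jointly stationary if their cross inner products are
invariant under a common shift; a single sequence `x` is stationary if `JointlyStationary x x`. -/
def JointlyStationary (x y : ℤ → E) : Prop :=
  ∀ m n, inner ℂ (y m) (x n) = inner ℂ (y 0) (x (n - m))

/-- The Cesàro means of the Fourier series of a stationary sequence are nonnegative, being the
square norm of a vector up to a positive factor. -/
theorem fourierCesaroSum_stationary {x : ℤ → E} (hx : JointlyStationary x x) (N : ℕ) (ω : ℝ) :
    fourierCesaroSum (fun k => inner ℂ (x 0) (x k)) N ω =
      ((1 / (2 * Real.pi * (N + 1)) *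
        ‖∑ n ∈ Finset.range (N + 1), trigChar (-n) ω • x n‖ ^ 2 : ℝ) : ℂ) := by
  have hn (v : E) : ((‖v‖ : ℂ)) ^ 2 = inner ℂ v v := (inner_self_eq_norm_sq_to_K v).symm
  push_cast
  rw [hn, fourierCesaroSum]
  simp only [fourierPartialSum]
  rw [sum_range_sum_Icc_neg, sum_inner]
  simp only [inner_sum, inner_smul_left, inner_smul_right, ← trigChar_neg, neg_neg]
  rw [Finset.mul_sum, Finset.mul_sum]
  refine Finset.sum_congr rfl fun m _ => ?_
  rw [Finset.mul_sum, Finset.mul_sum]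
  refine Finset.sum_congr rfl fun n _ => ?_
  rw [hx m n, neg_sub, sub_eq_add_neg (m : ℤ), trigChar_add]
  have : (Real.pi : ℂ) ≠ 0 := by exact_mod_cast Real.pi_ne_zero
  have : (N : ℂ) + 1 ≠ 0 := by exact_mod_cast N.succ_ne_zero
  field_simp

end Stationary

theorem integrableOn_Ico_of_continuous {f : ℝ → ℂ} (hf : Continuous f) :
    IntegrableOn f (Set.Ico 0 (2 * Real.pi)) :=
  (hf.integrableOn_Icc (a := 0) (b := 2 * Real.pi)).mono_set Set.Ico_subset_Icc_self

theorem integral_Ico_fourierPartialSum (R : ℤ → ℂ) (N : ℕ) (k : ℤ) :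
    ∫ ω in Set.Ico 0 (2 * Real.pi), fourierPartialSum R N ω * trigChar k ω =
      if |k| ≤ N then R k else 0 := by
  have h (ω : ℝ) : fourierPartialSum R N ω * trigChar k ω =
      ∑ n ∈ Finset.Icc (-(N : ℤ)) N, (1 / (2 * Real.pi) : ℂ) * R n * trigChar (k - n) ω := by
    rw [fourierPartialSum, Finset.sum_mul]
    refine Finset.sum_congr rfl fun n _ => ?_
    rw [sub_eq_add_neg, trigChar_add]; ring
  simp only [h]
  rw [integral_finsetSum _ (by
    intro n _
    exact integrableOn_Ico_of_continuous (continuous_const.mul (continuous_trigChar _)))]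
  simp only [integral_const_mul, integral_Ico_trigChar, sub_eq_zero, mul_ite, mul_zero]
  rw [Finset.sum_ite_eq]
  simp only [Finset.mem_Icc, ← abs_le]
  have : (Real.pi : ℂ) ≠ 0 := by exact_mod_cast Real.pi_ne_zero
  congr 1
  field_simp

theorem integral_Ico_fourierCesaroSum (R : ℤ → ℂ) (N : ℕ) (k : ℤ) :
    ∫ ω in Set.Ico 0 (2 * Real.pi), fourierCesaroSum R N ω * trigChar k ω =
      (1 / ((N : ℂ) + 1)) * ∑ M ∈ Finset.range (N + 1), if |k| ≤ M then R k else 0 := by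
  simp only [fourierCesaroSum, mul_assoc, Finset.sum_mul]
  rw [integral_const_mul, integral_finsetSum _ (by
    intro M _
    exact integrableOn_Ico_of_continuous
      ((continuous_fourierPartialSum R M).mul (continuous_trigChar k)))]
  simp only [integral_Ico_fourierPartialSum]

/-- Convergence of a sequence implies convergence of its arithmetic means. -/
theorem tendsto_cesaro {u : ℕ → ℂ} {s : ℂ} (h : Tendsto u atTop (𝓝 s)) :
    Tendsto (fun N : ℕ => (1 / ((N : ℂ) + 1)) * ∑ M ∈ Finset.range (N + 1), u M) atTop (𝓝 s) := by
  have := (tendsto_add_atTop_iff_nat 1).2 h.cesaro_smul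
  refine this.congr fun N => ?_
  rw [Complex.real_smul]; push_cast; rw [one_div]

theorem tendsto_integral_Ico_fourierCesaroSum (R : ℤ → ℂ) (k : ℤ) :
    Tendsto (fun N => ∫ ω in Set.Ico 0 (2 * Real.pi), fourierCesaroSum R N ω * trigChar k ω)
      atTop (𝓝 (R k)) := by
  simp only [integral_Ico_fourierCesaroSum]
  refine tendsto_cesaro (tendsto_const_nhds.congr' ?_)
  filter_upwards [eventually_ge_atTop k.natAbs] with M hM
  rw [if_pos (by rw [Int.abs_eq_natAbs]; exact_mod_cast hM)]

/-! ### Herglotz' theorem and the spectral representation -/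

section Herglotz

variable {E : Type*} [NormedAddCommGroup E] [InnerProductSpace ℂ E]

theorem continuous_cesaroDensity (x : ℤ → E) (N : ℕ) :
    Continuous fun ω : ℝ => 1 / (2 * Real.pi * (N + 1)) *
      ‖∑ n ∈ Finset.range (N + 1), trigChar (-n) ω • x n‖ ^ 2 :=
  continuous_const.mul ((continuous_finsetSum _ fun _ _ =>
    (continuous_trigChar _).smul continuous_const).norm.pow 2)

/-- The Cesàro mean of a stationary sequence, as the density of a positive measure on `[0, 2π)`. -/
noncomputable def cesaroMeasure (x : ℤ → E) (N : ℕ) : Measure ℝ :=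
  (volume.restrict (Set.Ico 0 (2 * Real.pi))).withDensity fun ω =>
    ENNReal.ofReal (1 / (2 * Real.pi * (N + 1)) *
      ‖∑ n ∈ Finset.range (N + 1), trigChar (-n) ω • x n‖ ^ 2)

theorem integral_cesaroMeasure {x : ℤ → E} (hx : JointlyStationary x x) (N : ℕ) (f : ℝ → ℂ) :
    ∫ ω, f ω ∂(cesaroMeasure x N) = ∫ ω in Set.Ico 0 (2 * Real.pi),
      fourierCesaroSum (fun k => inner ℂ (x 0) (x k)) N ω * f ω := by
  have hc := continuous_cesaroDensity x N
  rw [cesaroMeasure, integral_withDensity_eq_integral_toReal_smul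
    hc.measurable.ennreal_ofReal (by simp)]
  refine integral_congr_ae (.of_forall fun ω => ?_)
  simp only
  rw [ENNReal.toReal_ofReal (by positivity), fourierCesaroSum_stationary hx, Complex.real_smul]

theorem isFiniteMeasure_cesaroMeasure (x : ℤ → E) (N : ℕ) :
    IsFiniteMeasure (cesaroMeasure x N) := by
  have hc := continuous_cesaroDensity x N
  refine isFiniteMeasure_withDensity_ofReal ?_
  exact ((hc.integrableOn_Icc (a := 0) (b := 2 * Real.pi)).mono_set
    Set.Ico_subset_Icc_self).hasFiniteIntegral

theorem tendsto_integral_cesaroMeasure {x : ℤ → E} (hx : JointlyStationary x x) (k : ℤ) :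
    Tendsto (fun N => ∫ ω, trigChar k ω ∂(cesaroMeasure x N)) atTop
      (𝓝 (inner ℂ (x 0) (x k))) := by
  simp only [integral_cesaroMeasure hx]
  exact tendsto_integral_Ico_fourierCesaroSum _ k

theorem cesaroMeasure_real_univ {x : ℤ → E} (hx : JointlyStationary x x) (N : ℕ) :
    (cesaroMeasure x N).real Set.univ = ‖x 0‖ ^ 2 := by
  have h := integral_cesaroMeasure hx N (trigChar 0)
  have hn (v : E) : ((‖v‖ : ℂ)) ^ 2 = inner ℂ v v := (inner_self_eq_norm_sq_to_K v).symm
  rw [integral_Ico_fourierCesaroSum] at h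
  have h1 : (N : ℂ) + 1 ≠ 0 := by exact_mod_cast N.succ_ne_zero
  simp only [trigChar_zero, integral_const, abs_zero, Nat.cast_nonneg, if_true,
    Finset.sum_const, Finset.card_range, ← hn] at h
  rw [Complex.real_smul, mul_one, nsmul_eq_mul] at h
  push_cast at h
  rw [← mul_assoc, one_div, inv_mul_cancel₀ h1, one_mul] at h
  exact_mod_cast h

/-- **Herglotz' theorem**: the covariances of a stationary sequence are the Fourier coefficients of
a finite measure on `[0, 2π)`. The measure is a limit point of the Cesàro means of the Fourier
series, which form a bounded, hence relatively compact, sequence of measures on the circle. -/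
theorem exists_spectralMeasure {x : ℤ → E} (hx : JointlyStationary x x) :
    ∃ ν : Measure ℝ, IsFiniteMeasure ν ∧ ν (Set.Ico 0 (2 * Real.pi))ᶜ = 0 ∧
      ∀ k, ∫ ω, trigChar k ω ∂ν = inner ℂ (x 0) (x k) := by
  have hfin := isFiniteMeasure_cesaroMeasure x
  let u (N : ℕ) : FiniteMeasure (AddCircle (2 * Real.pi)) :=
    ⟨(cesaroMeasure x N).map ((↑) : ℝ → AddCircle (2 * Real.pi)), inferInstance⟩
  have hu (N : ℕ) : u N ∈ {m : FiniteMeasure (AddCircle (2 * Real.pi)) |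
      m.mass ≤ (‖x 0‖₊ ^ 2)} := by
    have h1 : (cesaroMeasure x N) Set.univ = ENNReal.ofReal (‖x 0‖ ^ 2) := by
      rw [← cesaroMeasure_real_univ hx N, ofReal_measureReal]
    have h2 : (u N : Measure (AddCircle (2 * Real.pi))) Set.univ = ENNReal.ofReal (‖x 0‖ ^ 2) := by
      rw [← h1]
      exact Measure.map_apply AddCircle.measurable_mk' MeasurableSet.univ
    have h3 : ((u N).mass : ℝ≥0∞) = ((‖x 0‖₊ ^ 2 : NNReal) : ℝ≥0∞) := by
      rw [FiniteMeasure.ennreal_mass, h2, ENNReal.ofReal]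
      congr 1
      exact Real.toNNReal_of_nonneg (by positivity)
    exact le_of_eq (by exact_mod_cast h3)
  -- A limit along an ultrafilter needs only compactness, not sequential compactness.
  obtain ⟨m, -, hm⟩ := (isCompact_setOfPred_finiteMeasure_le_of_compactSpace
    (AddCircle (2 * Real.pi)) (‖x 0‖₊ ^ 2)).ultrafilter_le_nhds
    ((Ultrafilter.of atTop).map u) (by
      rw [le_principal_iff]
      exact Filter.mem_map.2 (Filter.univ_mem' hu))
  have hconv : Tendsto u ((Ultrafilter.of atTop : Ultrafilter ℕ) : Filter ℕ) (𝓝 m) := hm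
  refine ⟨(m : Measure _).map circleRep, inferInstance, ?_, fun k => ?_⟩
  · rw [Measure.map_apply measurable_circleRep measurableSet_Ico.compl]
    convert measure_empty (μ := (m : Measure (AddCircle (2 * Real.pi))))
    ext y
    simpa using circleRep_mem y
  · rw [integral_map measurable_circleRep.aemeasurable
      (continuous_trigChar k).aestronglyMeasurable]
    have h1 (y : AddCircle (2 * Real.pi)) : trigChar k (circleRep y) = fourier k y := by
      rw [← fourier_coe_eq_trigChar, coe_circleRep]
    simp only [h1]
    have h2 := (FiniteMeasure.tendsto_iff_forall_integral_rclike_tendsto ℂ).1 hconv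
      (BoundedContinuousFunction.mkOfCompact (fourier k))
    refine tendsto_nhds_unique h2 ?_
    refine ((tendsto_integral_cesaroMeasure hx k).mono_left (Ultrafilter.of_le atTop)).congr ?_
    intro N
    simp only [← fourier_coe_eq_trigChar]
    exact (integral_map AddCircle.measurable_mk'.aemeasurable
      (fourier k).continuous.aestronglyMeasurable).symm

/-- A spectral representation of a sequence `x` in a Hilbert space: a finite measure `ν` carried by
`[0, 2π)` and an isometric embedding of `L²(ν)` that sends the `k`-th character to `x k`. -/
structure SpectralRepresentation (x : ℤ → E) where
  /-- The spectral measure. -/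
  ν : Measure ℝ
  finite : IsFiniteMeasure ν
  carried : ν (Set.Ico 0 (2 * Real.pi))ᶜ = 0
  /-- The isometric embedding; its value at an indicator function is the random measure. -/
  embed : Lp ℂ 2 ν →ₗᵢ[ℂ] E
  embed_trigCharLp : ∀ k, embed (trigCharLp 2 ν k) = x k

theorem inner_trigCharLp (ν : Measure ℝ) [IsFiniteMeasure ν] (m n : ℤ) :
    inner ℂ (trigCharLp 2 ν m) (trigCharLp 2 ν n) = ∫ ω, trigChar (n - m) ω ∂ν := by
  rw [L2.inner_def]
  refine integral_congr_ae ?_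
  filter_upwards [coeFn_trigCharLp 2 ν m, coeFn_trigCharLp 2 ν n] with ω h1 h2
  rw [h1, h2, trigChar_sub]
  rfl

/-- The Gram matrices of the sequence and of the characters in `L²` of the spectral measure agree,
so matching them extends to an isometry. -/
theorem exists_spectralRepresentation [CompleteSpace E] {x : ℤ → E}
    (hx : JointlyStationary x x) : Nonempty (SpectralRepresentation x) := by
  obtain ⟨ν, hfin, hν, hk⟩ := exists_spectralMeasure hx
  let S := Finsupp.linearCombination ℂ (trigCharLp 2 ν)
  let T := Finsupp.linearCombination ℂ x
  have hdense : DenseRange S := by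
    have := span_trigCharLp_closure_eq_top (p := 2) (by simp) hν
    rw [← Submodule.dense_iff_topologicalClosure_eq_top, ← Finsupp.range_linearCombination] at this
    exact this
  have hinner (c : ℤ →₀ ℂ) : inner ℂ (T c) (T c) = inner ℂ (S c) (S c) := by
    simp only [T, S, Finsupp.linearCombination_apply, Finsupp.sum, sum_inner, inner_sum,
      inner_smul_left, inner_smul_right, inner_trigCharLp, hk]
    refine Finset.sum_congr rfl fun n _ => congrArg _ (Finset.sum_congr rfl fun m _ => ?_)
    rw [hx]
  have hnorm (c : ℤ →₀ ℂ) : ‖T c‖ = ‖S c‖ := by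
    rw [@norm_eq_sqrt_re_inner ℂ, @norm_eq_sqrt_re_inner ℂ, hinner]
  have hbd : ∃ C : ℝ, ∀ c, ‖T c‖ ≤ C * ‖S c‖ := ⟨1, fun c => by rw [hnorm, one_mul]⟩
  refine ⟨⟨ν, hfin, hν, ⟨(T.extendOfNorm S : Lp ℂ 2 ν →ₗ[ℂ] E), fun f => ?_⟩, fun k => ?_⟩⟩
  · refine hdense.induction_on (p := fun f => ‖T.extendOfNorm S f‖ = ‖f‖) f
      (isClosed_eq (by fun_prop) continuous_norm) fun c => ?_
    rw [LinearMap.extendOfNorm_eq hdense hbd, hnorm]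
  · have h := LinearMap.extendOfNorm_eq hdense hbd (Finsupp.single k 1)
    simpa [S, T] using h

end Herglotz

/-! ### Vector measures and cross spectral measures -/

theorem hasSum_indicatorConstLp_iUnion (ν : Measure ℝ) [IsFiniteMeasure ν] {f : ℕ → Set ℝ}
    (hf : ∀ i, MeasurableSet (f i)) (hd : Pairwise (Function.onFun Disjoint f)) :
    HasSum (fun i => indicatorConstLp 2 (hf i) (measure_ne_top ν (f i)) (1 : ℂ))
      (indicatorConstLp 2 (MeasurableSet.iUnion hf) (measure_ne_top ν _) (1 : ℂ)) := by
  have hm (s : Finset ℕ) : MeasurableSet (⋃ i ∈ s, f i) :=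
    Finset.measurableSet_biUnion _ fun i _ => hf i
  have hsum (s : Finset ℕ) :
      ∑ i ∈ s, indicatorConstLp 2 (hf i) (measure_ne_top ν (f i)) (1 : ℂ) =
        indicatorConstLp 2 (hm s) (measure_ne_top ν _) (1 : ℂ) := by
    induction s using Finset.induction_on with
    | empty => simp
    | insert a s ha ih =>
      have hdis : Disjoint (f a) (⋃ i ∈ s, f i) := by
        rw [Set.disjoint_iUnion₂_right]
        exact fun i hi => hd (fun h => ha (h ▸ hi))
      rw [Finset.sum_insert ha, ih, ← indicatorConstLp_disjoint_union (hf a) (hm s)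
        (measure_ne_top ν _) (measure_ne_top ν _) hdis]
      congr 1
      simp
  rw [HasSum]
  simp only [hsum]
  refine tendsto_indicatorConstLp_set (by simp) ?_
  have h1 (s : Finset ℕ) : ν (symmDiff (⋃ i ∈ s, f i) (⋃ i, f i)) =
      ν (⋃ i, f i) - ∑ i ∈ s, ν (f i) := by
    have hsub : (⋃ i ∈ s, f i) ⊆ ⋃ i, f i := Set.iUnion₂_subset fun i _ => Set.subset_iUnion f i
    rw [symmDiff_of_le hsub, measure_sdiff hsub (hm s).nullMeasurableSet (measure_ne_top ν _),
      measure_biUnion_finset (fun i _ j _ hij => hd hij) fun i _ => hf i]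
  simp only [h1]
  have h2 : HasSum (fun i => ν (f i)) (ν (⋃ i, f i)) := by
    rw [measure_iUnion hd hf]
    exact ENNReal.summable.hasSum
  have h3 := ENNReal.Tendsto.sub (tendsto_const_nhds (x := ν (⋃ i, f i))) h2
    (Or.inl (measure_ne_top ν _))
  simpa using h3

namespace SpectralRepresentation

variable {E : Type*} [NormedAddCommGroup E] [InnerProductSpace ℂ E]

attribute [instance] SpectralRepresentation.finite

open Classical in
/-- The vector measure of a spectral representation: it sends a Borel set to the image of its
indicator function. -/
noncomputable def toVectorMeasure {x : ℤ → E} (S : SpectralRepresentation x) :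
    VectorMeasure ℝ E where
  measureOf' A := if hA : MeasurableSet A then
    S.embed (indicatorConstLp 2 hA (measure_ne_top S.ν A) 1) else 0
  empty' := by simp
  not_measurable' A hA := by simp [hA]
  m_iUnion' f hf hd := by
    simp only [hf, MeasurableSet.iUnion hf, dite_true]
    exact (hasSum_indicatorConstLp_iUnion S.ν hf hd).mapL S.embed.toContinuousLinearMap

theorem toVectorMeasure_apply {x : ℤ → E} (S : SpectralRepresentation x) {A : Set ℝ}
    (hA : MeasurableSet A) :
    S.toVectorMeasure A = S.embed (indicatorConstLp 2 hA (measure_ne_top S.ν A) 1) :=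
  dif_pos hA

theorem norm_sq_toVectorMeasure {x : ℤ → E} (S : SpectralRepresentation x) {A : Set ℝ}
    (hA : MeasurableSet A) : ENNReal.ofReal (‖S.toVectorMeasure A‖ ^ 2) = S.ν A := by
  rw [toVectorMeasure_apply S hA, LinearIsometry.norm_map,
    norm_indicatorConstLp (by simp) (by simp), norm_one, one_mul, ← Real.rpow_natCast,
    ← Real.rpow_mul measureReal_nonneg]
  simp

theorem toVectorMeasure_eq_zero {x : ℤ → E} (S : SpectralRepresentation x) {A : Set ℝ}
    (hA : MeasurableSet A) (hd : Disjoint A (Set.Ico 0 (2 * Real.pi))) :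
    S.toVectorMeasure A = 0 := by
  have h := S.norm_sq_toVectorMeasure hA
  rw [measure_mono_null hd.subset_compl_right S.carried, ENNReal.ofReal_eq_zero] at h
  exact norm_eq_zero.1 (pow_eq_zero_iff two_ne_zero |>.1 (le_antisymm h (by positivity)))

/-- The `L²` function whose conjugate is the density, relative to `S.ν`, of the cross spectral
measure of a sequence represented by `S` and a sequence with initial value `v`. -/
noncomputable def crossDensity [CompleteSpace E] {x : ℤ → E} (S : SpectralRepresentation x)
    (v : E) : Lp ℂ 2 S.ν :=
  ContinuousLinearMap.adjoint S.embed.toContinuousLinearMap v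

theorem inner_crossDensity [CompleteSpace E] {x : ℤ → E} (S : SpectralRepresentation x) (v : E)
    (f : Lp ℂ 2 S.ν) : inner ℂ (S.crossDensity v) f = inner ℂ v (S.embed f) :=
  ContinuousLinearMap.adjoint_inner_left _ _ _

theorem memLp_trigChar_mul {ν : Measure ℝ} (w : Lp ℂ 2 ν) (m : ℤ) :
    MemLp (fun ω => trigChar m ω * w ω) 2 ν := by
  refine (Lp.memLp w).of_le
    ((continuous_trigChar m).aestronglyMeasurable.mul (Lp.aestronglyMeasurable w))
    (.of_forall fun ω => ?_)
  rw [norm_mul, norm_trigChar, one_mul]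

theorem integral_trigChar_mul_crossDensity [CompleteSpace E] {x : ℤ → E}
    (S : SpectralRepresentation x) (v : E) (k : ℤ) :
    ∫ ω, trigChar k ω * conj (S.crossDensity v ω) ∂S.ν = inner ℂ v (x k) := by
  rw [← S.embed_trigCharLp k, ← inner_crossDensity, L2.inner_def]
  refine integral_congr_ae ?_
  filter_upwards [coeFn_trigCharLp 2 S.ν k] with ω h
  rw [h]
  rfl

/-- By stationarity, shifting the second sequence multiplies the density by a character. -/
theorem inner_embed_of_jointlyStationary [CompleteSpace E] {x y : ℤ → E}
    (S : SpectralRepresentation x) (h : JointlyStationary x y) (m : ℤ) (f : Lp ℂ 2 S.ν) :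
    inner ℂ (y m) (S.embed f) =
      inner ℂ (memLp_trigChar_mul (S.crossDensity (y 0)) m).toLp f := by
  have key : (innerSL ℂ (y m)).comp S.embed.toContinuousLinearMap =
      innerSL ℂ (memLp_trigChar_mul (S.crossDensity (y 0)) m).toLp := by
    refine ContinuousLinearMap.ext_on ?_ (s := Set.range (trigCharLp 2 S.ν)) ?_
    · rw [Submodule.dense_iff_topologicalClosure_eq_top]
      exact span_trigCharLp_closure_eq_top (by simp) S.carried
    · rintro _ ⟨k, rfl⟩
      simp only [ContinuousLinearMap.comp_apply, innerSL_apply_apply,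
        LinearIsometry.coe_toContinuousLinearMap]
      rw [S.embed_trigCharLp, h m k, ← S.integral_trigChar_mul_crossDensity, L2.inner_def]
      refine integral_congr_ae ?_
      filter_upwards [coeFn_trigCharLp 2 S.ν k,
        (memLp_trigChar_mul (S.crossDensity (y 0)) m).coeFn_toLp] with ω h1 h2
      rw [h1, h2, trigChar_sub, RCLike.inner_apply, map_mul]
      ring
  exact congrArg (fun L => L f) key

theorem memLp_indicator_conj {ν : Measure ℝ} (w : Lp ℂ 2 ν) {A : Set ℝ} (hA : MeasurableSet A) :
    MemLp (A.indicator fun ω => conj (w ω)) 2 ν :=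
  (memLp_conj (Lp.memLp w)).indicator hA

theorem memLp_indicator_one (p : ℝ≥0∞) (ν : Measure ℝ) [IsFiniteMeasure ν] {A : Set ℝ}
    (hA : MeasurableSet A) : MemLp (A.indicator fun _ => (1 : ℂ)) p ν :=
  memLp_indicator_const p hA 1 (Or.inr (measure_ne_top ν A))

/-- The cross moments of the vector measures of two jointly stationary sequences are given by a
complex measure. -/
theorem inner_toVectorMeasure [CompleteSpace E] {x y : ℤ → E} (S : SpectralRepresentation x)
    (S' : SpectralRepresentation y) (h : JointlyStationary x y) {A B : Set ℝ}
    (hA : MeasurableSet A) (hB : MeasurableSet B) :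
    inner ℂ (S'.toVectorMeasure B) (S.toVectorMeasure A) =
      ∫ ω in A ∩ B, conj (S.crossDensity (y 0) ω) ∂S.ν := by
  set w := S.crossDensity (y 0) with hw
  have hu := memLp_indicator_conj w hA
  -- `B` is replaced by the characters: the two sides are linear functionals on different `L²`
  -- spaces, so the approximation has to be simultaneous.
  have key := map_toLp_eq_of_trigCharLp (p := 2) (by simp) S.carried S'.carried
    (innerSL ℂ hu.toLp)
    ((innerSL ℂ (S.toVectorMeasure A)).comp S'.embed.toContinuousLinearMap) (fun m => by
      simp only [ContinuousLinearMap.comp_apply, innerSL_apply_apply,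
        LinearIsometry.coe_toContinuousLinearMap]
      rw [S'.embed_trigCharLp, ← inner_conj_symm (S.toVectorMeasure A),
        S.toVectorMeasure_apply hA, S.inner_embed_of_jointlyStationary h, inner_conj_symm,
        L2.inner_def, L2.inner_def]
      refine integral_congr_ae ?_
      filter_upwards [coeFn_trigCharLp 2 S.ν m, hu.coeFn_toLp,
        (memLp_trigChar_mul w m).coeFn_toLp,
        indicatorConstLp_coeFn (p := 2) (hs := hA) (hμs := measure_ne_top S.ν A) (c := (1 : ℂ))]
        with ω h1 h2 h3 h4
      rw [h1, h2, h3, h4, RCLike.inner_apply, RCLike.inner_apply]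
      by_cases hω : ω ∈ A <;> simp [hω])
    (memLp_indicator_one 2 (S.ν + S'.ν) hB)
  simp only [ContinuousLinearMap.comp_apply, innerSL_apply_apply,
    LinearIsometry.coe_toContinuousLinearMap] at key
  rw [← inner_conj_symm, S'.toVectorMeasure_apply hB]
  refine (congrArg conj key).symm.trans ?_
  rw [inner_conj_symm, L2.inner_def, ← integral_indicator (hA.inter hB)]
  refine integral_congr_ae ?_
  filter_upwards [hu.coeFn_toLp, (memLp_indicator_one 2 S.ν hB).coeFn_toLp] with ω h1 h2
  rw [RCLike.inner_apply, h1]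
  erw [h2]
  by_cases hω : ω ∈ A <;> by_cases hω' : ω ∈ B <;> simp [hω, hω']

/-- A continuous linear map that carries one stationary sequence into another carries the vector
measure of the first into that of the second. -/
theorem map_toVectorMeasure {x y : ℤ → E} (S : SpectralRepresentation x)
    (S' : SpectralRepresentation y) (P : E →L[ℂ] E) (hP : ∀ k, P (x k) = y k) {A : Set ℝ}
    (hA : MeasurableSet A) : P (S.toVectorMeasure A) = S'.toVectorMeasure A := by
  rw [S.toVectorMeasure_apply hA, S'.toVectorMeasure_apply hA]
  exact map_toLp_eq_of_trigCharLp (p := 2) (by simp) S.carried S'.carried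
    (P.comp S.embed.toContinuousLinearMap) S'.embed.toContinuousLinearMap
    (fun k => by simp [S.embed_trigCharLp, S'.embed_trigCharLp, hP])
    (memLp_indicator_one 2 (S.ν + S'.ν) hA)

end SpectralRepresentation

/-- Functions of `L²` with respect to two measures on `[0, 2π)` define the same complex measure if
they have the same Fourier coefficients. -/
theorem setIntegral_eq_of_trigChar {m m' : Measure ℝ} [IsFiniteMeasure m] [IsFiniteMeasure m']
    (hm : m (Set.Ico 0 (2 * Real.pi))ᶜ = 0) (hm' : m' (Set.Ico 0 (2 * Real.pi))ᶜ = 0)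
    {h h' : ℝ → ℂ} (hh : MemLp h 2 m) (hh' : MemLp h' 2 m')
    (heq : ∀ k, ∫ ω, trigChar k ω * h ω ∂m = ∫ ω, trigChar k ω * h' ω ∂m') {A : Set ℝ}
    (hA : MeasurableSet A) : ∫ ω in A, h ω ∂m = ∫ ω in A, h' ω ∂m' := by
  have main (m : Measure ℝ) [IsFiniteMeasure m] {h : ℝ → ℂ} (hh : MemLp h 2 m) :
      ∃ F : Lp ℂ 2 m →L[ℂ] ℂ, ∀ {g : ℝ → ℂ} (hg : MemLp g 2 m),
        F hg.toLp = ∫ ω, g ω * h ω ∂m := by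
    have hc := memLp_conj hh
    refine ⟨innerSL ℂ hc.toLp, fun {g} hg => ?_⟩
    rw [innerSL_apply_apply, L2.inner_def]
    refine integral_congr_ae ?_
    filter_upwards [hc.coeFn_toLp, hg.coeFn_toLp] with ω h1 h2
    rw [h1, h2, RCLike.inner_apply, RingHomCompTriple.comp_apply, RingHom.id_apply]
  obtain ⟨F, hF⟩ := main m hh
  obtain ⟨F', hF'⟩ := main m' hh'
  have key := map_toLp_eq_of_trigCharLp (p := 2) (by simp) hm hm' F F'
    (fun k => by rw [trigCharLp, trigCharLp, hF, hF', heq])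
    (SpectralRepresentation.memLp_indicator_one 2 (m + m') hA)
  rw [hF, hF'] at key
  rw [← integral_indicator hA, ← integral_indicator hA]
  convert key using 2
  all_goals
    funext ω
    by_cases hω : ω ∈ A <;> simp [hω]

/-! ### Random orthogonal measures and their integrals -/

namespace SpectralRepresentation

variable {Ω : Type*} [MeasurableSpace Ω] {μ : Measure Ω} {x : ℤ → Lp ℂ 2 μ}

/-- The vector measure of a spectral representation in `L²(μ)` is a random orthogonal measure. -/
noncomputable def randomMeasure (S : SpectralRepresentation x) : OrthogonalRandomMeasure μ where
  toVectorMeasure := S.toVectorMeasure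
  orthogonal A B hA hB hd := by
    rw [← OrthogonalRandomMeasure.inner_eq_mixedMoment, S.toVectorMeasure_apply hA,
      S.toVectorMeasure_apply hB, LinearIsometry.inner_map_map,
      L2.inner_indicatorConstLp_one_indicatorConstLp_one hB hA, hd.symm.inter_eq]
    simp

theorem controlMeasure_randomMeasure (S : SpectralRepresentation x) :
    S.randomMeasure.controlMeasure = S.ν := by
  ext A hA
  rw [OrthogonalRandomMeasure.controlMeasure_apply _ hA]
  exact S.norm_sq_toVectorMeasure hA

theorem simpleIntegral_randomMeasure (S : SpectralRepresentation x) (s : SimpleFunc ℝ ℂ) :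
    S.randomMeasure.simpleIntegral s =
      S.embed (s.memLp_of_isFiniteMeasure 2 S.ν).toLp := by
  have h (c : ℂ) : S.randomMeasure (s ⁻¹' {c}) = S.embed
      (indicatorConstLp 2 (s.measurableSet_fiber c) (measure_ne_top S.ν _) 1) :=
    S.toVectorMeasure_apply (s.measurableSet_fiber c)
  simp only [OrthogonalRandomMeasure.simpleIntegral, h, ← map_smul, ← map_sum]
  congr 1
  refine Lp.ext ?_
  have h1 := Lp.coeFn_finsetSum s.range (fun c : ℂ =>
    c • indicatorConstLp 2 (s.measurableSet_fiber c)
    (measure_ne_top S.ν _) (1 : ℂ))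
  have h2 : ∀ᵐ ω ∂S.ν, ∀ c ∈ s.range, (c • indicatorConstLp 2 (s.measurableSet_fiber c)
      (measure_ne_top S.ν _) (1 : ℂ) : Lp ℂ 2 S.ν) ω =
        c * (s ⁻¹' {c}).indicator (fun _ => (1 : ℂ)) ω := by
    rw [Filter.eventually_all_finset]
    intro c _
    filter_upwards [Lp.coeFn_smul c (indicatorConstLp 2 (s.measurableSet_fiber c)
      (measure_ne_top S.ν _) (1 : ℂ)), indicatorConstLp_coeFn (p := 2)
        (hs := s.measurableSet_fiber c) (hμs := measure_ne_top S.ν _) (c := (1 : ℂ))] with ω h1 h2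
    rw [h1, Pi.smul_apply, h2, smul_eq_mul]
  filter_upwards [h1, h2, (s.memLp_of_isFiniteMeasure 2 S.ν).coeFn_toLp] with ω h1 h2 h3
  rw [h1, h3, Finset.sum_apply, Finset.sum_congr rfl h2,
    Finset.sum_eq_single_of_mem (s ω) (s.mem_range_self ω)]
  · simp
  · intro c _ hc
    rw [Set.indicator_of_notMem (by simpa using hc.symm), mul_zero]

theorem hasIntegral_randomMeasure (S : SpectralRepresentation x) {f : ℝ → ℂ}
    (hf : MemLp f 2 S.ν) : S.randomMeasure.HasIntegral f (S.embed hf.toLp) := by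
  rw [OrthogonalRandomMeasure.HasIntegral, controlMeasure_randomMeasure]
  refine ⟨hf, fun s hs => ?_⟩
  simp only [simpleIntegral_randomMeasure]
  refine (S.embed.continuous.tendsto _).comp ?_
  rw [Lp.tendsto_Lp_iff_tendsto_eLpNorm'']
  exact hs

end SpectralRepresentation

/-! ### Partial sums of the sawtooth series -/

/-- The `N`-th partial sum `∑_{n=1}^N sin(nx)/n` of the Fourier series of the sawtooth function
`(π - x)/2` on `(0, 2π)`. -/
noncomputable def sawtoothSum (N : ℕ) (x : ℝ) : ℝ :=
  ∑ n ∈ Finset.range N, Real.sin ((n + 1) * x) / (n + 1)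

theorem sawtoothSum_neg (N : ℕ) (x : ℝ) : sawtoothSum N (-x) = -sawtoothSum N x := by
  simp [sawtoothSum, neg_div]

theorem sawtoothSum_two_pi_sub (N : ℕ) (x : ℝ) :
    sawtoothSum N (2 * Real.pi - x) = -sawtoothSum N x := by
  rw [sawtoothSum, sawtoothSum, ← Finset.sum_neg_distrib]
  refine Finset.sum_congr rfl fun n _ => ?_
  have : ((n : ℝ) + 1) * (2 * Real.pi - x) = ((n + 1 : ℕ) : ℝ) * (2 * Real.pi) - (n + 1) * x := by
    push_cast; ring
  rw [this, Real.sin_nat_mul_two_pi_sub, neg_div]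

theorem hasDerivAt_sawtoothSum (N : ℕ) (x : ℝ) :
    HasDerivAt (sawtoothSum N) (∑ n ∈ Finset.range N, Real.cos ((n + 1) * x)) x := by
  unfold sawtoothSum
  refine HasDerivAt.fun_sum fun n _ => ?_
  have hn : ((n : ℝ) + 1) ≠ 0 := by positivity
  have h := (((hasDerivAt_id' x).const_mul ((n : ℝ) + 1)).sin).div_const ((n : ℝ) + 1)
  refine h.congr_deriv ?_
  field_simp

theorem abs_sawtoothSum_le_mul (N : ℕ) (x : ℝ) : |sawtoothSum N x| ≤ N * |x| := by
  refine (Finset.abs_sum_le_sum_abs _ _).trans ?_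
  have : ∀ n ∈ Finset.range N, |Real.sin ((n + 1) * x) / (n + 1)| ≤ |x| := by
    intro n _
    have hn : (0 : ℝ) < n + 1 := by positivity
    rw [abs_div, abs_of_pos hn, div_le_iff₀ hn]
    refine Real.abs_sin_le_abs.trans ?_
    rw [abs_mul, abs_of_pos hn, mul_comm]
  simpa using Finset.sum_le_sum this

/-- The closed form of the Dirichlet kernel. -/
theorem sin_half_mul_dirichlet (N : ℕ) (x : ℝ) :
    2 * Real.sin (x / 2) * (1 / 2 + ∑ n ∈ Finset.range N, Real.cos ((n + 1) * x)) =
      Real.sin ((N + 1 / 2) * x) := by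
  induction N with
  | zero => simp; ring_nf
  | succ N ih =>
    rw [Finset.sum_range_succ, ← add_assoc, mul_add, ih]
    have h1 : ((N + 1 : ℕ) + 1 / 2 : ℝ) * x = (N + 1) * x + x / 2 := by push_cast; ring
    have h2 : (N + 1 / 2 : ℝ) * x = (N + 1) * x - x / 2 := by ring
    rw [h1, h2, Real.sin_add, Real.sin_sub]
    ring

theorem sawtoothSum_pi (N : ℕ) : sawtoothSum N Real.pi = 0 := by
  have := sawtoothSum_two_pi_sub N Real.pi
  rw [show 2 * Real.pi - Real.pi = Real.pi by ring] at this
  linarith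

/-- With `m = N + 1/2` and `g(t) = 1/(2 sin(t/2))`, the difference of the partial sum and the
sawtooth has derivative `sin(mt) g(t)`. Adding `cos(mt) g(t)/m` leaves the derivative
`cos(mt) g'(t)/m`, which is dominated by that of the decreasing function `g/m`. -/
theorem abs_sawtoothSum_sub_le (N : ℕ) {x : ℝ} (hx0 : 0 < x) (hxpi : x ≤ Real.pi) :
    |sawtoothSum N x - (Real.pi - x) / 2| ≤ 1 / ((N + 1 / 2) * Real.sin (x / 2)) := by
  set m : ℝ := N + 1 / 2 with hm
  have hm0 : 0 < m := by positivity
  let g : ℝ → ℝ := fun t => 1 / (2 * Real.sin (t / 2))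
  let g' : ℝ → ℝ := fun t => -Real.cos (t / 2) / (4 * Real.sin (t / 2) ^ 2)
  have hsin {t : ℝ} (h0 : 0 < t) (h1 : t ≤ Real.pi) : 0 < Real.sin (t / 2) :=
    Real.sin_pos_of_pos_of_lt_pi (by linarith) (by linarith [Real.pi_pos])
  have hg' {t : ℝ} (h0 : 0 < t) (h1 : t ≤ Real.pi) : g' t ≤ 0 := by
    have := Real.cos_nonneg_of_neg_pi_div_two_le_of_le (x := t / 2) (by linarith) (by linarith)
    exact div_nonpos_of_nonpos_of_nonneg (by linarith) (by positivity)
  have hdg {t : ℝ} (h0 : 0 < t) (h1 : t ≤ Real.pi) : HasDerivAt g (g' t) t := by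
    have hs := (hsin h0 h1).ne'
    have h := ((((hasDerivAt_id' t).div_const 2).sin).const_mul 2).inv
      (mul_ne_zero two_ne_zero hs)
    have hgi : g = fun t => (2 * Real.sin (t / 2))⁻¹ := by funext t; simp only [g, one_div]
    rw [hgi]
    refine h.congr_deriv ?_
    simp only [g']
    field_simp
    ring
  let h : ℝ → ℝ := fun t => sawtoothSum N t - (Real.pi - t) / 2 + Real.cos (m * t) * g t / m
  have hdh {t : ℝ} (h0 : 0 < t) (h1 : t ≤ Real.pi) :
      HasDerivAt h (Real.cos (m * t) * g' t / m) t := by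
    have hs := (hsin h0 h1).ne'
    have hd := ((hasDerivAt_sawtoothSum N t).sub
      (((hasDerivAt_id' t).const_sub Real.pi).div_const 2)).add
      (((((hasDerivAt_id' t).const_mul m).cos).mul (hdg h0 h1)).div_const m)
    refine hd.congr_deriv ?_
    have hk := sin_half_mul_dirichlet N t
    rw [← hm] at hk
    simp only [g]
    rw [← hk]
    generalize ∑ n ∈ Finset.range N, Real.cos ((n + 1) * t) = d
    field_simp
    ring
  have hpi : h Real.pi = 0 := by
    have : Real.cos (m * Real.pi) = 0 := by
      rw [hm, add_mul, one_div, inv_mul_eq_div, Real.cos_add_pi_div_two, Real.sin_nat_mul_pi,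
        neg_zero]
    simp [h, this, sawtoothSum_pi]
  have hgpi : 0 ≤ g Real.pi := by simp [g]
  have hmem {t : ℝ} (ht : t ∈ Set.Icc x Real.pi) : 0 < t ∧ t ≤ Real.pi :=
    ⟨hx0.trans_le ht.1, ht.2⟩
  have up : h x - g x / m ≤ 0 := by
    have hmono : MonotoneOn (fun t => h t - g t / m) (Set.Icc x Real.pi) := by
      have hd {t : ℝ} (ht : t ∈ Set.Icc x Real.pi) : HasDerivAt (fun t => h t - g t / m)
          (Real.cos (m * t) * g' t / m - g' t / m) t :=
        (hdh (hmem ht).1 (hmem ht).2).sub ((hdg (hmem ht).1 (hmem ht).2).div_const m)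
      refine monotoneOn_of_deriv_nonneg (convex_Icc _ _)
        (fun t ht => (hd ht).continuousAt.continuousWithinAt)
        (fun t ht => (hd (interior_subset ht)).differentiableAt.differentiableWithinAt)
        (fun t ht => ?_)
      have ht := interior_subset ht
      rw [(hd ht).deriv, ← sub_div]
      refine div_nonneg ?_ hm0.le
      nlinarith [hg' (hmem ht).1 (hmem ht).2, Real.cos_le_one (m * t)]
    have := hmono ⟨le_rfl, hxpi⟩ ⟨hxpi, le_rfl⟩ hxpi
    simp only [hpi] at this
    have := div_nonneg hgpi hm0.le
    linarith
  have lo : 0 ≤ h x + g x / m := by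
    have hmono : AntitoneOn (fun t => h t + g t / m) (Set.Icc x Real.pi) := by
      have hd {t : ℝ} (ht : t ∈ Set.Icc x Real.pi) : HasDerivAt (fun t => h t + g t / m)
          (Real.cos (m * t) * g' t / m + g' t / m) t :=
        (hdh (hmem ht).1 (hmem ht).2).add ((hdg (hmem ht).1 (hmem ht).2).div_const m)
      refine antitoneOn_of_deriv_nonpos (convex_Icc _ _)
        (fun t ht => (hd ht).continuousAt.continuousWithinAt)
        (fun t ht => (hd (interior_subset ht)).differentiableAt.differentiableWithinAt)
        (fun t ht => ?_)
      have ht := interior_subset ht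
      rw [(hd ht).deriv, ← add_div]
      refine div_nonpos_of_nonpos_of_nonneg ?_ hm0.le
      nlinarith [hg' (hmem ht).1 (hmem ht).2, Real.neg_one_le_cos (m * t)]
    have := hmono ⟨le_rfl, hxpi⟩ ⟨hxpi, le_rfl⟩ hxpi
    simp only [hpi] at this
    have := div_nonneg hgpi hm0.le
    linarith
  have hgx : 0 ≤ g x / m := div_nonneg (by have := hsin hx0 hxpi; positivity) hm0.le
  have hcos : |Real.cos (m * x) * g x / m| ≤ g x / m := by
    rw [mul_div_assoc, abs_mul, abs_of_nonneg hgx]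
    exact mul_le_of_le_one_left hgx (Real.abs_cos_le_one _)
  have h2 : 1 / (m * Real.sin (x / 2)) = g x / m + g x / m := by
    have := (hsin hx0 hxpi).ne'
    simp only [g]
    field_simp
    ring
  rw [h2, abs_le]
  rw [abs_le] at hcos
  simp only [h] at up lo
  constructor <;> linarith [hcos.1, hcos.2]

/-- Near `0` the terms are bounded one by one, elsewhere the distance to the sawtooth is bounded. -/
theorem abs_sawtoothSum_le_of_le_pi (N : ℕ) {x : ℝ} (hx0 : 0 < x) (hxpi : x ≤ Real.pi) :
    |sawtoothSum N x| ≤ 6 := by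
  rcases le_or_gt (((N : ℝ) + 1 / 2) * x) 1 with h | h
  · have := abs_sawtoothSum_le_mul N x
    rw [abs_of_pos hx0] at this
    nlinarith
  · have h1 := abs_sawtoothSum_sub_le N hx0 hxpi
    have h2 : x / Real.pi ≤ Real.sin (x / 2) := by
      have := Real.mul_le_sin (x := x / 2) (by linarith) (by linarith)
      refine le_trans (le_of_eq ?_) this
      field_simp
    have h3 : 1 / ((N + 1 / 2) * Real.sin (x / 2)) ≤ Real.pi := by
      have hs : 0 < Real.sin (x / 2) := (div_pos hx0 Real.pi_pos).trans_le h2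
      rw [div_le_iff₀ (by positivity)]
      have h4 : x ≤ Real.pi * Real.sin (x / 2) := by
        rw [div_le_iff₀ Real.pi_pos] at h2; linarith
      nlinarith [mul_le_mul_of_nonneg_left h4 (by positivity : (0 : ℝ) ≤ N + 1 / 2)]
    rw [abs_le] at h1 ⊢
    have := Real.pi_lt_four
    constructor <;> linarith [h1.1, h1.2]

theorem abs_sawtoothSum_le (N : ℕ) {x : ℝ} (hx : |x| ≤ 2 * Real.pi) : |sawtoothSum N x| ≤ 6 := by
  have main {y : ℝ} (h0 : 0 ≤ y) (h1 : y ≤ 2 * Real.pi) : |sawtoothSum N y| ≤ 6 := by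
    have hz : sawtoothSum N 0 = 0 := by simp [sawtoothSum]
    rcases h0.eq_or_lt with rfl | h0
    · simp [hz]
    rcases h1.eq_or_lt with rfl | h1
    · have := sawtoothSum_two_pi_sub N 0
      rw [sub_zero, hz, neg_zero] at this
      simp [this]
    rcases le_total y Real.pi with h | h
    · exact abs_sawtoothSum_le_of_le_pi N h0 h
    · have := abs_sawtoothSum_le_of_le_pi N (x := 2 * Real.pi - y) (by linarith) (by linarith)
      rwa [sawtoothSum_two_pi_sub, abs_neg] at this
  rw [abs_le] at hx
  rcases le_total 0 x with h | h
  · exact main h hx.2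
  · have := main (y := -x) (by linarith) (by linarith)
    rwa [sawtoothSum_neg, abs_neg] at this

theorem tendsto_sawtoothSum {x : ℝ} (hx0 : 0 < x) (hx1 : x < 2 * Real.pi) :
    Tendsto (fun N => sawtoothSum N x) atTop (𝓝 ((Real.pi - x) / 2)) := by
  have main {y : ℝ} (h0 : 0 < y) (h1 : y ≤ Real.pi) :
      Tendsto (fun N => sawtoothSum N y) atTop (𝓝 ((Real.pi - y) / 2)) := by
    rw [tendsto_iff_norm_sub_tendsto_zero]
    refine squeeze_zero (fun N => norm_nonneg _) (fun N => abs_sawtoothSum_sub_le N h0 h1) ?_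
    have hs : 0 < Real.sin (y / 2) :=
      Real.sin_pos_of_pos_of_lt_pi (by linarith) (by linarith [Real.pi_pos])
    refine Tendsto.const_div_atTop ?_ _
    exact (tendsto_atTop_add_const_right _ _ tendsto_natCast_atTop_atTop).atTop_mul_const hs
  rcases le_total x Real.pi with h | h
  · exact main hx0 h
  · have := (main (y := 2 * Real.pi - x) (by linarith) (by linarith)).neg
    simp only [sawtoothSum_two_pi_sub, neg_neg] at this
    convert this using 2
    ring

theorem tendsto_sawtoothSum_of_neg {x : ℝ} (hx0 : x < 0) (hx1 : -(2 * Real.pi) < x) :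
    Tendsto (fun N => sawtoothSum N x) atTop (𝓝 ((-Real.pi - x) / 2)) := by
  have := (tendsto_sawtoothSum (x := -x) (by linarith) (by linarith)).neg
  simp only [sawtoothSum_neg, neg_neg] at this
  convert this using 2
  ring

/-! ### Integrals of Fourier partial sums over intervals -/

theorem integrable_trigChar_mul {ν : Measure ℝ} {h : ℝ → ℂ} (hh : Integrable h ν) (n : ℤ) :
    Integrable (fun l => trigChar n l * h l) ν :=
  hh.bdd_mul (continuous_trigChar n).aestronglyMeasurable
    (.of_forall fun l => (norm_trigChar n l).le)

theorem fourierPartialSum_eq_integral {ν : Measure ℝ} {h : ℝ → ℂ} (hh : Integrable h ν) (N : ℕ)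
    (ω : ℝ) : fourierPartialSum (fun k => ∫ l, trigChar k l * h l ∂ν) N ω =
      ∫ l, fourierPartialSum (fun k => trigChar k l) N ω * h l ∂ν := by
  simp only [fourierPartialSum, Finset.sum_mul]
  rw [integral_finsetSum]
  · refine Finset.sum_congr rfl fun n _ => ?_
    rw [mul_right_comm, ← integral_const_mul]
    refine integral_congr_ae (.of_forall fun l => ?_)
    simp only
    ring
  · intro n _
    refine ((integrable_trigChar_mul hh n).const_mul
      ((1 / (2 * Real.pi) : ℂ) * trigChar (-n) ω)).congr
      (.of_forall fun l => ?_)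
    simp only
    ring

theorem integrable_fourierPartialSum_mul {ν : Measure ℝ} {h : ℝ → ℂ} (hh : Integrable h ν) (N : ℕ)
    (ω : ℝ) : Integrable (fun l => fourierPartialSum (fun k => trigChar k l) N ω * h l) ν := by
  simp only [fourierPartialSum, Finset.sum_mul]
  refine integrable_finsetSum _ fun n _ => ?_
  refine ((integrable_trigChar_mul hh n).const_mul
    ((1 / (2 * Real.pi) : ℂ) * trigChar (-n) ω)).congr (.of_forall fun l => ?_)
  simp only
  ring

theorem fourierCesaroSum_eq_integral {ν : Measure ℝ} {h : ℝ → ℂ} (hh : Integrable h ν) (N : ℕ)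
    (ω : ℝ) : fourierCesaroSum (fun k => ∫ l, trigChar k l * h l ∂ν) N ω =
      ∫ l, fourierCesaroSum (fun k => trigChar k l) N ω * h l ∂ν := by
  simp only [fourierCesaroSum, fourierPartialSum_eq_integral hh, mul_assoc, Finset.sum_mul]
  rw [integral_const_mul, integral_finsetSum _ fun M _ => integrable_fourierPartialSum_mul hh M ω]

theorem fourierPartialSum_trigChar (l ω : ℝ) (N : ℕ) :
    fourierPartialSum (fun k => trigChar k l) N ω =
      ((1 / (2 * Real.pi) * (1 + 2 * ∑ n ∈ Finset.range N, Real.cos ((n + 1) * (l - ω))) : ℝ) :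
        ℂ) := by
  have hmul (n : ℤ) : trigChar n l * trigChar (-n) ω = trigChar n (l - ω) := by
    rw [trigChar, trigChar, trigChar, ← Complex.exp_add]; push_cast; ring_nf
  have hcos (n : ℤ) (y : ℝ) : trigChar (-n) y + trigChar n y =
      ((2 * Real.cos (n * y) : ℝ) : ℂ) := by
    rw [trigChar, trigChar]
    push_cast
    rw [Complex.two_cos]
    ring_nf
  simp only [fourierPartialSum, mul_assoc, hmul]
  rw [← Finset.mul_sum, sum_Icc_neg_eq, ← Finset.sum_range_reflect]
  push_cast
  congr 1
  rw [trigChar_zero, Finset.mul_sum]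
  congr 1
  refine Finset.sum_congr rfl fun n hn => ?_
  have hn' : n < N := Finset.mem_range.1 hn
  have h1 : ((N - 1 - n : ℕ) : ℤ) - N = -((n : ℤ) + 1) := by omega
  have h2 : (N : ℤ) - ((N - 1 - n : ℕ) : ℤ) = (n : ℤ) + 1 := by omega
  rw [h1, h2, hcos]
  push_cast
  rfl

/-- The `N`-th partial sum at `l` of the Fourier series of the indicator function of `(a, b)`. -/
noncomputable def indicatorKernel (a b : ℝ) (N : ℕ) (l : ℝ) : ℝ :=
  1 / (2 * Real.pi) * ((b - a) + 2 * (sawtoothSum N (l - a) - sawtoothSum N (l - b)))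

/-- The kernel is the integral over `(a, b)` of the Dirichlet kernel. -/
theorem intervalIntegral_fourierPartialSum_trigChar (a b l : ℝ) (N : ℕ) :
    ∫ ω in a..b, fourierPartialSum (fun k => trigChar k l) N ω = (indicatorKernel a b N l : ℂ) := by
  simp only [fourierPartialSum_trigChar]
  rw [intervalIntegral.integral_ofReal]
  congr 1
  have hd (ω : ℝ) : HasDerivAt (fun ω => 1 / (2 * Real.pi) * (ω - 2 * sawtoothSum N (l - ω)))
      (1 / (2 * Real.pi) * (1 + 2 * ∑ n ∈ Finset.range N, Real.cos ((n + 1) * (l - ω)))) ω := by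
    have h := ((hasDerivAt_id' ω).sub (((hasDerivAt_sawtoothSum N (l - ω)).comp ω
      ((hasDerivAt_id' ω).const_sub l)).const_mul 2)).const_mul (1 / (2 * Real.pi))
    refine h.congr_deriv ?_
    ring
  rw [intervalIntegral.integral_eq_sub_of_hasDerivAt (fun ω _ => hd ω)
    (Continuous.intervalIntegrable (by fun_prop) _ _), indicatorKernel]
  ring

theorem intervalIntegral_fourierPartialSum (R : ℤ → ℂ) (N : ℕ) (a b : ℝ) :
    ∫ ω in a..b, fourierPartialSum R N ω =
      ∑ n ∈ Finset.Icc (-(N : ℤ)) N,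
        (1 / (2 * Real.pi) : ℂ) * R n * ∫ ω in a..b, trigChar (-n) ω := by
  simp only [fourierPartialSum]
  rw [intervalIntegral.integral_finsetSum]
  · simp only [intervalIntegral.integral_const_mul]
  · intro n _
    exact (continuous_const.mul (continuous_trigChar (-n))).intervalIntegrable _ _

theorem intervalIntegral_fourierPartialSum_eq_integral {ν : Measure ℝ} {h : ℝ → ℂ}
    (hh : Integrable h ν) (N : ℕ) (a b : ℝ) :
    ∫ ω in a..b, fourierPartialSum (fun k => ∫ l, trigChar k l * h l ∂ν) N ω =
      ∫ l, (indicatorKernel a b N l : ℂ) * h l ∂ν := by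
  simp only [← intervalIntegral_fourierPartialSum_trigChar, intervalIntegral_fourierPartialSum,
    Finset.sum_mul]
  rw [integral_finsetSum]
  · refine Finset.sum_congr rfl fun n _ => ?_
    rw [mul_right_comm, ← integral_const_mul]
    refine integral_congr_ae (.of_forall fun l => ?_)
    simp only
    ring
  · intro n _
    refine ((integrable_trigChar_mul hh n).const_mul
      ((1 / (2 * Real.pi) : ℂ) * ∫ ω in a..b, trigChar (-n) ω)).congr
      (.of_forall fun l => ?_)
    simp only
    ring

theorem abs_indicatorKernel_le {a b l : ℝ} (ha : 0 ≤ a) (hab : a ≤ b) (hb : b ≤ 2 * Real.pi)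
    (hl : l ∈ Set.Ico 0 (2 * Real.pi)) (N : ℕ) :
    |indicatorKernel a b N l| ≤ 1 / (2 * Real.pi) * (2 * Real.pi + 24) := by
  have hpi := Real.pi_pos
  have h1 := abs_le.1 (abs_sawtoothSum_le N (x := l - a)
    (abs_le.2 ⟨by linarith [hl.1], by linarith [hl.2]⟩))
  have h2 := abs_le.1 (abs_sawtoothSum_le N (x := l - b)
    (abs_le.2 ⟨by linarith [hl.1], by linarith [hl.2]⟩))
  rw [indicatorKernel, abs_mul, abs_of_pos (by positivity : 0 < 1 / (2 * Real.pi))]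
  refine mul_le_mul_of_nonneg_left (abs_le.2 ⟨?_, ?_⟩) (by positivity)
  · linarith [h1.1, h1.2, h2.1, h2.2]
  · linarith [h1.1, h1.2, h2.1, h2.2]

/-- Since `l < 2π`, the end point `b = 2π` is the point `0` of the circle, which has to be
excluded. -/
theorem tendsto_indicatorKernel {a b l : ℝ} (ha : 0 ≤ a) (hab : a ≤ b) (hb : b ≤ 2 * Real.pi)
    (hl : l ∈ Set.Ico 0 (2 * Real.pi)) (hla : l ≠ a) (hlb : l ≠ b)
    (h0 : b = 2 * Real.pi → l ≠ 0) :
    Tendsto (fun N => indicatorKernel a b N l) atTop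
      (𝓝 ((Set.Ioo a b).indicator (fun _ => (1 : ℝ)) l)) := by
  have hpi := Real.pi_pos
  have main {s t : ℝ} (hs : Tendsto (fun N => sawtoothSum N (l - a)) atTop (𝓝 s))
      (ht : Tendsto (fun N => sawtoothSum N (l - b)) atTop (𝓝 t)) :
      Tendsto (fun N => indicatorKernel a b N l) atTop
        (𝓝 (1 / (2 * Real.pi) * ((b - a) + 2 * (s - t)))) :=
    (((hs.sub ht).const_mul 2).const_add (b - a)).const_mul _
  have hlow : -(2 * Real.pi) < l - b := by
    rcases hb.eq_or_lt with hb | hb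
    · have := lt_of_le_of_ne hl.1 (h0 hb).symm
      linarith
    · linarith [hl.1]
  rcases lt_or_gt_of_ne hla with h | h
  · convert main (tendsto_sawtoothSum_of_neg (by linarith) (by linarith))
      (tendsto_sawtoothSum_of_neg (by linarith) hlow) using 2
    rw [Set.indicator_of_notMem fun hm => absurd hm.1 (not_lt.2 h.le)]
    ring
  · rcases lt_or_gt_of_ne hlb with h' | h'
    · convert main (tendsto_sawtoothSum (by linarith) (by linarith [hl.2]))
        (tendsto_sawtoothSum_of_neg (by linarith) hlow) using 2
      rw [Set.indicator_of_mem (Set.mem_Ioo.2 ⟨h, h'⟩)]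
      field_simp
      ring
    · convert main (tendsto_sawtoothSum (by linarith) (by linarith [hl.2]))
        (tendsto_sawtoothSum (by linarith) (by linarith [hl.2])) using 2
      rw [Set.indicator_of_notMem fun hm => absurd hm.2 (not_lt.2 h'.le)]
      ring

theorem ae_eq_zero_of_setIntegral_singleton {ν : Measure ℝ} [IsFiniteMeasure ν] {h : ℝ → ℂ} {a : ℝ}
    (ha : ∫ ω in {a}, h ω ∂ν = 0) : ∀ᵐ l ∂ν, l = a → h l = 0 := by
  rw [Measure.restrict_singleton, integral_smul_measure, integral_dirac] at ha
  rcases smul_eq_zero.1 ha with h0 | h0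
  · have h1 : ν {a} = 0 := by
      rcases (ENNReal.toReal_eq_zero_iff _).1 h0 with h | h
      · exact h
      · exact absurd h (measure_ne_top ν _)
    have : ∀ᵐ l ∂ν, l ≠ a := by simpa [ae_iff] using h1
    filter_upwards [this] with l hl h using absurd h hl
  · exact .of_forall fun l hl => hl ▸ h0

/-- Term by term integration of the Fourier series of a complex measure over an interval whose end
points carry no mass: the Fourier series of the indicator function of the interval converges
boundedly, off the end points to the indicator function itself. -/
theorem tendsto_intervalIntegral_fourierPartialSum {ν : Measure ℝ} [IsFiniteMeasure ν]
    (hν : ν (Set.Ico 0 (2 * Real.pi))ᶜ = 0) {h : ℝ → ℂ} (hh : Integrable h ν) {a b : ℝ}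
    (ha : 0 ≤ a) (hab : a ≤ b) (hb : b ≤ 2 * Real.pi) (hDa : ∫ ω in {a}, h ω ∂ν = 0)
    (hDb : ∫ ω in {b}, h ω ∂ν = 0) (hD0 : b = 2 * Real.pi → ∫ ω in {0}, h ω ∂ν = 0) :
    Tendsto (fun N => ∫ ω in a..b, fourierPartialSum (fun k => ∫ l, trigChar k l * h l ∂ν) N ω)
      atTop (𝓝 (∫ ω in Set.Ioo a b, h ω ∂ν)) := by
  simp only [intervalIntegral_fourierPartialSum_eq_integral hh]
  rw [← integral_indicator measurableSet_Ioo]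
  have hIco : ∀ᵐ l ∂ν, l ∈ Set.Ico 0 (2 * Real.pi) := by rwa [ae_iff]
  have h0 : ∀ᵐ l ∂ν, b = 2 * Real.pi → l = 0 → h l = 0 := by
    by_cases hb' : b = 2 * Real.pi
    · filter_upwards [ae_eq_zero_of_setIntegral_singleton (hD0 hb')] with l hl _ using hl
    · exact .of_forall fun l h => absurd h hb'
  refine tendsto_integral_of_dominated_convergence
    (fun l => (1 / (2 * Real.pi) * (2 * Real.pi + 24)) * ‖h l‖) (fun N => ?_)
    (hh.norm.const_mul _) (fun N => ?_) ?_
  · have : Continuous (indicatorKernel a b N) := by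
      unfold indicatorKernel sawtoothSum; fun_prop
    exact (Complex.continuous_ofReal.comp this).aestronglyMeasurable.mul hh.1
  · filter_upwards [hIco] with l hl
    rw [norm_mul, Complex.norm_real]
    exact mul_le_mul_of_nonneg_right (abs_indicatorKernel_le ha hab hb hl N) (norm_nonneg _)
  · filter_upwards [hIco, ae_eq_zero_of_setIntegral_singleton hDa,
      ae_eq_zero_of_setIntegral_singleton hDb, h0] with l hl hla hlb hl0
    by_cases hz : h l = 0
    · simp [hz, Set.indicator]
    · have := tendsto_indicatorKernel ha hab hb hl (fun e => hz (hla e)) (fun e => hz (hlb e))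
        (fun e e' => hz (hl0 e e'))
      have h2 := ((Complex.continuous_ofReal.tendsto _).comp this).mul_const (h l)
      suffices hi : (Set.Ioo a b).indicator h l =
          (((Set.Ioo a b).indicator (fun _ => (1 : ℝ)) l : ℝ) : ℂ) * h l by rw [hi]; exact h2
      by_cases hm : l ∈ Set.Ioo a b
      · rw [Set.indicator_of_mem hm, Set.indicator_of_mem hm, Complex.ofReal_one, one_mul]
      · rw [Set.indicator_of_notMem hm, Set.indicator_of_notMem hm, Complex.ofReal_zero, zero_mul]

/-! ### Cesàro means of integrable functions -/

/-- Lebesgue measure on `[0, 2π)`. -/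
noncomputable abbrev volumeIco : Measure ℝ := volume.restrict (Set.Ico 0 (2 * Real.pi))

theorem volumeIco_compl : volumeIco (Set.Ico 0 (2 * Real.pi))ᶜ = 0 := by
  rw [Measure.restrict_apply measurableSet_Ico.compl]; simp

theorem continuous_fejerKernel (N : ℕ) :
    Continuous fun z : ℝ × ℝ => fourierCesaroSum (fun k => trigChar k z.2) N z.1 := by
  unfold fourierCesaroSum fourierPartialSum trigChar; fun_prop

/-- The Fejér kernel is nonnegative and has integral one. -/
theorem integral_norm_fejerKernel (l : ℝ) (N : ℕ) :
    ∫ ω, ‖fourierCesaroSum (fun k => trigChar k l) N ω‖ ∂volumeIco = 1 := by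
  have hst : JointlyStationary (fun k => trigChar k l) (fun k => trigChar k l) := by
    intro m n
    simp [RCLike.inner_apply, trigChar_sub]
  have hpos (ω : ℝ) : ∃ r : ℝ, 0 ≤ r ∧ fourierCesaroSum (fun k => trigChar k l) N ω = r := by
    have := fourierCesaroSum_stationary hst N ω
    simp only [RCLike.inner_apply, trigChar_zero, map_one, mul_one] at this
    exact ⟨_, by positivity, this⟩
  have hnorm (ω : ℝ) : ((‖fourierCesaroSum (fun k => trigChar k l) N ω‖ : ℝ) : ℂ) =
      fourierCesaroSum (fun k => trigChar k l) N ω * trigChar 0 ω := by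
    obtain ⟨r, hr, h⟩ := hpos ω
    rw [h, Complex.norm_real, Real.norm_of_nonneg hr, trigChar_zero, mul_one]
  have h1 := integral_Ico_fourierCesaroSum (fun k => trigChar k l) N 0
  simp only [← hnorm] at h1
  rw [integral_complex_ofReal] at h1
  have hN : (N : ℂ) + 1 ≠ 0 := by exact_mod_cast N.succ_ne_zero
  simp only [abs_zero, Nat.cast_nonneg, if_true, trigChar_zero, Finset.sum_const,
    Finset.card_range, nsmul_eq_mul, mul_one] at h1
  push_cast at h1
  rw [one_div, inv_mul_cancel₀ hN] at h1
  exact_mod_cast h1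

/-- Taking Cesàro means of Fourier series is a contraction of `L¹`. -/
theorem integral_norm_fourierCesaroSum_le {d : ℝ → ℂ} (hd : Integrable d volumeIco) (N : ℕ) :
    ∫ ω, ‖fourierCesaroSum (fun k => ∫ l, trigChar k l * d l ∂volumeIco) N ω‖ ∂volumeIco ≤
      ∫ ω, ‖d ω‖ ∂volumeIco := by
  have h2 (l : ℝ) :
      ∫ ω, ‖fourierCesaroSum (fun k => trigChar k l) N ω * d l‖ ∂volumeIco = ‖d l‖ := by
    simp only [norm_mul]
    rw [integral_mul_const, integral_norm_fejerKernel, one_mul]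
  have hK : Integrable (fun z : ℝ × ℝ => fourierCesaroSum (fun k => trigChar k z.2) N z.1 * d z.2)
      (volumeIco.prod volumeIco) := by
    have hd2 : AEStronglyMeasurable (fun z : ℝ × ℝ => d z.2) (volumeIco.prod volumeIco) :=
      hd.1.comp_snd
    have hm : AEStronglyMeasurable (fun z : ℝ × ℝ =>
        fourierCesaroSum (fun k => trigChar k z.2) N z.1) (volumeIco.prod volumeIco) :=
      (continuous_fejerKernel N).aestronglyMeasurable
    refine (integrable_prod_iff' (hm.mul hd2)).2 ⟨.of_forall fun l => ?_, ?_⟩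
    · have hi : Integrable (fourierCesaroSum (fun k => trigChar k l) N) volumeIco :=
        integrableOn_Ico_of_continuous (continuous_fourierCesaroSum _ N)
      exact hi.mul_const (d l)
    · exact hd.norm.congr (.of_forall fun l => (h2 l).symm)
  simp only [fourierCesaroSum_eq_integral hd]
  calc ∫ ω, ‖∫ l, fourierCesaroSum (fun k => trigChar k l) N ω * d l ∂volumeIco‖ ∂volumeIco
      ≤ ∫ ω, ∫ l, ‖fourierCesaroSum (fun k => trigChar k l) N ω * d l‖ ∂volumeIco ∂volumeIco :=
        integral_mono_of_nonneg (.of_forall fun _ => norm_nonneg _) hK.norm.integral_prod_left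
          (.of_forall fun ω => norm_integral_le_integral_norm _)
    _ = ∫ l, ∫ ω, ‖fourierCesaroSum (fun k => trigChar k l) N ω * d l‖ ∂volumeIco ∂volumeIco :=
        integral_integral_swap hK.norm
    _ = ∫ l, ‖d l‖ ∂volumeIco := by simp only [h2]

theorem fourierCesaroSum_add (R R' : ℤ → ℂ) (N : ℕ) (ω : ℝ) :
    fourierCesaroSum (fun k => R k + R' k) N ω =
      fourierCesaroSum R N ω + fourierCesaroSum R' N ω := by
  simp only [fourierCesaroSum, fourierPartialSum, mul_add, add_mul, Finset.sum_add_distrib]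

theorem fourierCesaroSum_const_mul (c : ℂ) (R : ℤ → ℂ) (N : ℕ) (ω : ℝ) :
    fourierCesaroSum (fun k => c * R k) N ω = c * fourierCesaroSum R N ω := by
  simp only [fourierCesaroSum, fourierPartialSum, Finset.mul_sum]
  refine Finset.sum_congr rfl fun M _ => Finset.sum_congr rfl fun n _ => ?_
  ring

/-- The `L¹` distance from an integrable function to the `N`-th Cesàro mean of its Fourier
series. -/
noncomputable def cesaroError (N : ℕ) (d : ℝ → ℂ) : ℝ :=
  ∫ ω, ‖fourierCesaroSum (fun k => ∫ l, trigChar k l * d l ∂volumeIco) N ω - d ω‖ ∂volumeIco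

theorem cesaroError_nonneg (N : ℕ) (d : ℝ → ℂ) : 0 ≤ cesaroError N d :=
  integral_nonneg fun _ => norm_nonneg _

theorem cesaroError_congr (N : ℕ) {d d' : ℝ → ℂ} (h : d =ᵐ[volumeIco] d') :
    cesaroError N d = cesaroError N d' := by
  have h1 (k : ℤ) : ∫ l, trigChar k l * d l ∂volumeIco = ∫ l, trigChar k l * d' l ∂volumeIco :=
    integral_congr_ae (by filter_upwards [h] with l hl; rw [hl])
  simp only [cesaroError, h1]
  exact integral_congr_ae (by filter_upwards [h] with l hl; rw [hl])

theorem integrable_cesaroError (N : ℕ) {d : ℝ → ℂ} (hd : Integrable d volumeIco) (R : ℤ → ℂ) :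
    Integrable (fun ω => ‖fourierCesaroSum R N ω - d ω‖) volumeIco :=
  ((integrableOn_Ico_of_continuous (continuous_fourierCesaroSum R N)).sub hd).norm

theorem cesaroError_add_le (N : ℕ) {d d' : ℝ → ℂ} (hd : Integrable d volumeIco)
    (hd' : Integrable d' volumeIco) :
    cesaroError N (fun ω => d ω + d' ω) ≤ cesaroError N d + cesaroError N d' := by
  rw [cesaroError, cesaroError, cesaroError, ← integral_add (integrable_cesaroError N hd _)
    (integrable_cesaroError N hd' _)]
  have h1 (k : ℤ) : ∫ l, trigChar k l * (d l + d' l) ∂volumeIco =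
      (∫ l, trigChar k l * d l ∂volumeIco) + ∫ l, trigChar k l * d' l ∂volumeIco := by
    simp only [mul_add]
    exact integral_add (integrable_trigChar_mul hd k) (integrable_trigChar_mul hd' k)
  refine integral_mono (integrable_cesaroError N (hd.add hd') _)
    ((integrable_cesaroError N hd _).add (integrable_cesaroError N hd' _)) fun ω => ?_
  simp only [h1, fourierCesaroSum_add]
  rw [add_sub_add_comm]
  exact norm_add_le _ _

theorem cesaroError_const_mul (N : ℕ) (c : ℂ) (d : ℝ → ℂ) :
    cesaroError N (fun ω => c * d ω) = ‖c‖ * cesaroError N d := by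
  rw [cesaroError, cesaroError, ← integral_const_mul]
  have h1 (k : ℤ) : ∫ l, trigChar k l * (c * d l) ∂volumeIco =
      c * ∫ l, trigChar k l * d l ∂volumeIco := by
    rw [← integral_const_mul]
    exact integral_congr_ae (.of_forall fun l => by simp only; ring)
  simp only [h1, fourierCesaroSum_const_mul, ← mul_sub, norm_mul]

theorem cesaroError_le (N : ℕ) {d : ℝ → ℂ} (hd : Integrable d volumeIco) :
    cesaroError N d ≤ 2 * ∫ ω, ‖d ω‖ ∂volumeIco := by
  have h1 := integral_norm_fourierCesaroSum_le hd N
  have h2 := integrableOn_Ico_of_continuous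
    (continuous_fourierCesaroSum (fun k => ∫ l, trigChar k l * d l ∂volumeIco) N)
  have h3 : cesaroError N d ≤ ∫ ω, (‖fourierCesaroSum
      (fun k => ∫ l, trigChar k l * d l ∂volumeIco) N ω‖ + ‖d ω‖) ∂volumeIco :=
    integral_mono (integrable_cesaroError N hd _) (h2.norm.add hd.norm) fun ω => norm_sub_le _ _
  rw [integral_add h2.norm hd.norm] at h3
  linarith

theorem tendsto_cesaroError_trigChar (k : ℤ) :
    Tendsto (fun N => cesaroError N (trigChar k)) atTop (𝓝 0) := by
  have hcoef (n : ℤ) : ∫ l, trigChar n l * trigChar k l ∂volumeIco =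
      if n = -k then (2 * Real.pi : ℂ) else 0 := by
    simp only [← trigChar_add, integral_Ico_trigChar, eq_neg_iff_add_eq_zero]
  have hpi : (Real.pi : ℂ) ≠ 0 := by exact_mod_cast Real.pi_ne_zero
  have hpart (M : ℕ) (ω : ℝ) : fourierPartialSum
      (fun n => if n = -k then (2 * Real.pi : ℂ) else 0) M ω =
        (if |k| ≤ M then 1 else 0) * trigChar k ω := by
    simp only [fourierPartialSum, mul_ite, ite_mul, mul_zero, zero_mul]
    rw [Finset.sum_ite_eq', neg_neg]
    have : -k ∈ Finset.Icc (-(M : ℤ)) M ↔ |k| ≤ M := by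
      rw [Finset.mem_Icc, ← abs_le, abs_neg]
    simp only [this]
    congr 1
    field_simp
  set a : ℕ → ℂ := fun N => (1 / ((N : ℂ) + 1)) *
    ∑ M ∈ Finset.range (N + 1), if |k| ≤ M then 1 else 0 with ha
  have hlim : Tendsto a atTop (𝓝 1) := by
    refine tendsto_cesaro (tendsto_const_nhds.congr' ?_)
    filter_upwards [eventually_ge_atTop k.natAbs] with M hM
    rw [if_pos (by rw [Int.abs_eq_natAbs]; exact_mod_cast hM)]
  have herr (N : ℕ) : cesaroError N (trigChar k) = ‖a N - 1‖ * (2 * Real.pi) := by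
    have h1 (ω : ℝ) : ‖fourierCesaroSum (fun n => if n = -k then (2 * Real.pi : ℂ) else 0) N ω -
        trigChar k ω‖ = ‖a N - 1‖ := by
      rw [fourierCesaroSum]
      simp only [hpart]
      rw [← Finset.sum_mul, ← mul_assoc, ← sub_one_mul, norm_mul, norm_trigChar, mul_one]
    simp only [cesaroError, hcoef, h1]
    simp [Real.pi_pos.le, mul_comm]
  simp only [herr]
  simpa using ((hlim.sub_const 1).norm).mul_const (2 * Real.pi)

/-- **Fejér's theorem** in `L¹`: the Cesàro means of the Fourier series of an integrable function
converge to it in mean. They do so for trigonometric polynomials, which are dense, and taking the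
means is a contraction. -/
theorem tendsto_cesaroError {d : ℝ → ℂ} (hd : Integrable d volumeIco) :
    Tendsto (fun N => cesaroError N d) atTop (𝓝 0) := by
  have hint (f : Lp ℂ 1 volumeIco) : Integrable f volumeIco :=
    memLp_one_iff_integrable.1 (Lp.memLp f)
  have hspan (f : Lp ℂ 1 volumeIco)
      (hf : f ∈ Submodule.span ℂ (Set.range (trigCharLp 1 volumeIco))) :
      Tendsto (fun N => cesaroError N f) atTop (𝓝 0) := by
    induction hf using Submodule.span_induction with
    | mem f hf =>
      obtain ⟨k, rfl⟩ := hf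
      exact (tendsto_cesaroError_trigChar k).congr fun N =>
        (cesaroError_congr N (coeFn_trigCharLp 1 volumeIco k)).symm
    | zero =>
      refine tendsto_const_nhds.congr fun N => ?_
      rw [cesaroError_congr N (d' := fun _ => (0 : ℂ) * 0)
        ((Lp.coeFn_zero ℂ 1 volumeIco).trans (.of_forall fun _ => by simp)),
        cesaroError_const_mul N 0 fun _ => 0]
      simp
    | add f g _ _ hf hg =>
      refine squeeze_zero (fun N => cesaroError_nonneg N _) (fun N => ?_) (by simpa using hf.add hg)
      rw [cesaroError_congr N (Lp.coeFn_add f g)]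
      exact cesaroError_add_le N (hint f) (hint g)
    | smul c f _ hf =>
      refine (by simpa using hf.const_mul ‖c‖ :
        Tendsto (fun N => ‖c‖ * cesaroError N f) atTop (𝓝 0)).congr fun N => ?_
      rw [cesaroError_congr N (Lp.coeFn_smul c f)]
      exact (cesaroError_const_mul N c f).symm
  have hdense := span_trigCharLp_closure_eq_top (p := 1) (by simp) volumeIco_compl
  rw [← Submodule.dense_iff_topologicalClosure_eq_top] at hdense
  have hd1 : MemLp d 1 volumeIco := memLp_one_iff_integrable.2 hd
  rw [Metric.tendsto_atTop]
  intro ε hε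
  obtain ⟨f, hf, hdist⟩ := Metric.dense_iff.1 hdense hd1.toLp (ε / 4) (by positivity)
  obtain ⟨N₀, hN₀⟩ := Metric.tendsto_atTop.1 (hspan f hdist) (ε / 2) (by positivity)
  refine ⟨N₀, fun N hN => ?_⟩
  have h1 := hN₀ N hN
  rw [Real.dist_0_eq_abs, abs_of_nonneg (cesaroError_nonneg _ _)] at h1 ⊢
  have hsub := hd.sub (hint f)
  have h2 : cesaroError N d ≤ cesaroError N (d - f) + cesaroError N f := by
    refine le_trans (le_of_eq ?_) (cesaroError_add_le N hsub (hint f))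
    exact cesaroError_congr N (.of_forall fun ω => by simp)
  have h3 := cesaroError_le N hsub
  have h4 : ∫ ω, ‖(d - f) ω‖ ∂volumeIco < ε / 4 := by
    rw [Metric.mem_ball, dist_comm, dist_eq_norm, L1.norm_eq_integral_norm] at hf
    refine lt_of_eq_of_lt (integral_congr_ae ?_) hf
    filter_upwards [Lp.coeFn_sub hd1.toLp f, hd1.coeFn_toLp] with ω e1 e2
    rw [e1, Pi.sub_apply, Pi.sub_apply, e2]
  linarith

/-- Almost everywhere, if the Fourier series of an integrable function converges, it converges to
the function: its Cesàro means have a subsequence that does so almost everywhere. -/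
theorem ae_eq_of_tendsto_fourierPartialSum {d : ℝ → ℂ} (hd : Integrable d volumeIco) :
    ∀ᵐ ω ∂volumeIco, ∀ s, Tendsto
      (fun N => fourierPartialSum (fun k => ∫ l, trigChar k l * d l ∂volumeIco) N ω) atTop (𝓝 s) →
        d ω = s := by
  have hL1 := tendsto_cesaroError hd
  set R : ℤ → ℂ := fun k => ∫ l, trigChar k l * d l ∂volumeIco with hR
  have hmeas : TendstoInMeasure volumeIco (fourierCesaroSum R) atTop d := by
    refine tendstoInMeasure_of_tendsto_eLpNorm one_ne_zero
      (fun N => (continuous_fourierCesaroSum R N).aestronglyMeasurable) hd.1 ?_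
    have h1 (N : ℕ) : eLpNorm (fourierCesaroSum R N - d) 1 volumeIco =
        ENNReal.ofReal (cesaroError N d) := by
      rw [eLpNorm_one_eq_lintegral_enorm, cesaroError, ofReal_integral_eq_lintegral_ofReal
        (integrable_cesaroError N hd _) (.of_forall fun _ => norm_nonneg _)]
      simp only [ofReal_norm]
      rfl
    simp only [h1]
    simpa using ENNReal.tendsto_ofReal hL1
  obtain ⟨ns, hns, hlim⟩ := hmeas.exists_seq_tendsto_ae
  filter_upwards [hlim] with ω hω s hs
  exact tendsto_nhds_unique hω ((tendsto_cesaro hs).comp hns.tendsto_atTop)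

/-! ### Spectral density series and second moments -/

theorem integral_simpleFunc_mul {ν : Measure ℝ} {h : ℝ → ℂ} (hh : Integrable h ν)
    (s : SimpleFunc ℝ ℂ) :
    ∫ l, s l * h l ∂ν = ∑ c ∈ s.range, c * ∫ l in s ⁻¹' {c}, h l ∂ν := by
  have h1 (l : ℝ) : s l * h l = ∑ c ∈ s.range, c * (s ⁻¹' {c}).indicator h l := by
    rw [Finset.sum_eq_single_of_mem (s l) (s.mem_range_self l)]
    · simp
    · intro c _ hc
      rw [Set.indicator_of_notMem (by simpa using hc.symm), mul_zero]
  simp only [h1]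
  rw [integral_finsetSum _ fun c _ => (hh.indicator (s.measurableSet_fiber c)).const_mul c]
  simp only [integral_const_mul, integral_indicator (s.measurableSet_fiber _)]

/-- Two representations of a complex measure by densities give the same integrals. -/
theorem integral_mul_eq_of_setIntegral_eq {ν ν' : Measure ℝ} {h h' : ℝ → ℂ} (hh : Integrable h ν)
    (hh' : Integrable h' ν')
    (heq : ∀ A, MeasurableSet A → ∫ l in A, h l ∂ν = ∫ l in A, h' l ∂ν')
    {f : ℝ → ℂ} (hf : Measurable f) {C : ℝ} (hC : ∀ l, ‖f l‖ ≤ C) :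
    ∫ l, f l * h l ∂ν = ∫ l, f l * h' l ∂ν' := by
  let s (n : ℕ) : SimpleFunc ℝ ℂ := SimpleFunc.approxOn f hf Set.univ 0 (Set.mem_univ _) n
  have hlim {ν : Measure ℝ} {h : ℝ → ℂ} (hh : Integrable h ν) :
      Tendsto (fun n => ∫ l, s n l * h l ∂ν) atTop (𝓝 (∫ l, f l * h l ∂ν)) := by
    refine tendsto_integral_of_dominated_convergence (fun l => (C + C) * ‖h l‖)
      (fun n => (s n).stronglyMeasurable.aestronglyMeasurable.mul hh.1) (hh.norm.const_mul _)
      (fun n => .of_forall fun l => ?_) (.of_forall fun l => ?_)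
    · rw [norm_mul]
      refine mul_le_mul_of_nonneg_right ?_ (norm_nonneg _)
      exact (SimpleFunc.norm_approxOn_zero_le hf (Set.mem_univ _) l n).trans
        (add_le_add (hC l) (hC l))
    · exact (SimpleFunc.tendsto_approxOn hf (Set.mem_univ _) (by simp)).mul_const (h l)
  refine tendsto_nhds_unique (hlim hh) ((hlim hh').congr fun n => ?_)
  rw [integral_simpleFunc_mul hh, integral_simpleFunc_mul hh']
  exact Finset.sum_congr rfl fun c _ => by rw [heq _ ((s n).measurableSet_fiber c)]

theorem summable_fourierTerm {R : ℤ → ℂ} (hR : Summable fun n => ‖R n‖) (ω : ℝ) :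
    Summable fun n => (1 / (2 * Real.pi) : ℂ) * R n * trigChar (-n) ω := by
  refine Summable.of_norm ?_
  simp only [norm_mul, norm_trigChar, mul_one]
  exact hR.mul_left _

theorem norm_tsum_fourierTerm_le {R : ℤ → ℂ} (hR : Summable fun n => ‖R n‖) (ω : ℝ) :
    ‖∑' n, (1 / (2 * Real.pi) : ℂ) * R n * trigChar (-n) ω‖ ≤
      ∑' n, ‖(1 / (2 * Real.pi) : ℂ)‖ * ‖R n‖ := by
  refine tsum_of_norm_bounded (hR.mul_left _).hasSum fun n => ?_
  rw [norm_mul, norm_mul, norm_trigChar, mul_one]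

theorem continuous_tsum_fourierTerm {R : ℤ → ℂ} (hR : Summable fun n => ‖R n‖) :
    Continuous fun ω => ∑' n, (1 / (2 * Real.pi) : ℂ) * R n * trigChar (-n) ω := by
  refine continuous_tsum (fun n => continuous_const.mul (continuous_trigChar (-n)))
    (hR.mul_left ‖(1 / (2 * Real.pi) : ℂ)‖) fun n ω => ?_
  rw [norm_mul, norm_mul, norm_trigChar, mul_one]

theorem integral_trigChar_mul_tsum {R : ℤ → ℂ} (hR : Summable fun n => ‖R n‖) (k : ℤ) :
    ∫ ω, trigChar k ω * ∑' n, (1 / (2 * Real.pi) : ℂ) * R n * trigChar (-n) ω ∂volumeIco = R k := by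
  have hpi : (Real.pi : ℂ) ≠ 0 := by exact_mod_cast Real.pi_ne_zero
  have hF (n : ℤ) (ω : ℝ) : trigChar k ω * ((1 / (2 * Real.pi) : ℂ) * R n * trigChar (-n) ω) =
      (1 / (2 * Real.pi) : ℂ) * R n * trigChar (k - n) ω := by
    rw [sub_eq_add_neg, trigChar_add]; ring
  have h1 := hasSum_integral_of_summable_integral_norm (μ := volumeIco)
    (F := fun (n : ℤ) ω => (1 / (2 * Real.pi) : ℂ) * R n * trigChar (k - n) ω)
    (fun n => (integrable_trigChar _ _).const_mul _) (by
      simp only [norm_mul, norm_trigChar, mul_one, integral_const, smul_eq_mul]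
      exact (hR.mul_left _).mul_left _)
  simp only [← tsum_mul_left, hF]
  rw [← h1.tsum_eq, tsum_eq_single k]
  · rw [integral_const_mul, integral_Ico_trigChar, sub_self, if_pos rfl]
    field_simp
  · intro n hn
    rw [integral_const_mul, integral_Ico_trigChar, if_neg (sub_ne_zero.2 hn.symm), mul_zero]

/-- A complex measure on `[0, 2π)` whose Fourier coefficients are `α^{-nH} Q(αⁿ)` has the spectral
density series determined by `Q`. -/
theorem hasSpectralDensitySeries_withDensity {ν : Measure ℝ} [IsFiniteMeasure ν]
    (hν : ν (Set.Ico 0 (2 * Real.pi))ᶜ = 0) {h : ℝ → ℂ} (hh : MemLp h 2 ν) {α H : ℝ} (hα : 0 < α)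
    {Q : ℝ → ℂ} (hQ : ∀ n : ℤ, ∫ l, trigChar n l * h l ∂ν =
      ((α ^ (-(n : ℝ) * H) : ℝ) : ℂ) * Q (α ^ n)) :
    HasSpectralDensitySeries α H Q (ν.withDensityᵥ h) := by
  have hint : Integrable h ν := hh.integrable (by norm_num)
  set R : ℤ → ℂ := fun n => ∫ l, trigChar n l * h l ∂ν with hR
  have hterm (n : ℤ) (ω : ℝ) : spectralTerm α H Q n ω =
      (1 / (2 * Real.pi) : ℂ) * R n * trigChar (-n) ω := by
    have : Complex.exp (-(Complex.I * ω * n)) = trigChar (-n) ω := by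
      rw [trigChar]; push_cast; ring_nf
    rw [spectralTerm, show R n = _ from hQ n, this]
    ring
  have hpart : spectralPartialSum α H Q = fourierPartialSum R := by
    funext N ω
    simp only [spectralPartialSum, fourierPartialSum, hterm]
  have hces : spectralCesaroSum α H Q = fourierCesaroSum R := by
    funext N ω
    simp only [spectralCesaroSum, fourierCesaroSum, hpart]
  have hD {A : Set ℝ} (hA : MeasurableSet A) : ν.withDensityᵥ h A = ∫ l in A, h l ∂ν :=
    withDensityᵥ_apply hint hA
  refine ⟨fun a b ha hab hb hDa hDb hD0 => ?_, fun d hd => ?_, fun hs => ?_⟩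
  · rw [hpart, hD measurableSet_Ioo]
    rw [hD (measurableSet_singleton _)] at hDa hDb hD0
    exact tendsto_intervalIntegral_fourierPartialSum hν hint ha hab hb hDa hDb hD0
  · have hdi : Integrable d volumeIco := hd.1
    have hRd : R = fun k => ∫ l, trigChar k l * d l ∂volumeIco := by
      funext k
      refine integral_mul_eq_of_setIntegral_eq hint hdi (fun A hA => ?_)
        (continuous_trigChar k).measurable (fun l => (norm_trigChar k l).le)
      rw [← hD hA, hd.2 A hA, Measure.restrict_restrict hA]
    rw [hces, hpart, hRd]
    exact ⟨tendsto_cesaroError hdi, ae_eq_of_tendsto_fourierPartialSum hdi⟩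
  · have hs' : Summable fun n => ‖R n‖ := by
      refine hs.congr fun n => ?_
      rw [hR]
      simp only
      rw [hQ, norm_mul, Complex.norm_real, Real.norm_of_nonneg (Real.rpow_nonneg hα.le _)]
    simp only [hterm]
    have hc := continuous_tsum_fourierTerm hs'
    refine ⟨summable_fourierTerm hs', integrableOn_Ico_of_continuous hc, fun A hA => ?_⟩
    rw [hD hA, ← Measure.restrict_restrict hA]
    exact setIntegral_eq_of_trigChar hν volumeIco_compl hh
      (MemLp.of_bound hc.aestronglyMeasurable _ (.of_forall (norm_tsum_fourierTerm_le hs')))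
      (fun k => (integral_trigChar_mul_tsum hs' k).symm) hA

section Probability

variable {Ω : Type*} [MeasurableSpace Ω] {μ : Measure Ω}

theorem mixedMoment_eq_inner {U V : Ω → ℂ} (hU : MemLp U 2 μ) (hV : MemLp V 2 μ) :
    mixedMoment μ U V = inner ℂ hV.toLp hU.toLp := by
  rw [OrthogonalRandomMeasure.inner_eq_mixedMoment]
  refine integral_congr_ae ?_
  filter_upwards [hU.coeFn_toLp, hV.coeFn_toLp] with x h1 h2
  rw [h1, h2]

variable [IsProbabilityMeasure μ]

variable (μ) in
/-- The centering map `U ↦ U - E U` of `L²(μ)`, as the projection along the constants. -/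
noncomputable def centering : Lp ℂ 2 μ →L[ℂ] Lp ℂ 2 μ :=
  ContinuousLinearMap.id ℂ _ -
    (innerSL ℂ (Lp.const 2 μ (1 : ℂ))).smulRight (Lp.const 2 μ (1 : ℂ))

theorem centering_apply (U : Lp ℂ 2 μ) :
    centering μ U = U - (∫ x, U x ∂μ) • Lp.const 2 μ (1 : ℂ) := by
  have h : inner ℂ (Lp.const 2 μ (1 : ℂ)) U = ∫ x, U x ∂μ := by
    rw [L2.inner_def]
    refine integral_congr_ae ?_
    filter_upwards [Lp.coeFn_const (p := 2) (μ := μ) (1 : ℂ)] with x hx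
    rw [hx, RCLike.inner_apply]
    simp
  rw [← h]
  rfl

theorem centering_toLp {U : Ω → ℂ} (hU : MemLp U 2 μ) :
    centering μ hU.toLp = (hU.sub (memLp_const (∫ y, U y ∂μ))).toLp := by
  rw [centering_apply, integral_congr_ae hU.coeFn_toLp]
  refine Lp.ext ?_
  filter_upwards [Lp.coeFn_sub hU.toLp ((∫ y, U y ∂μ) • Lp.const 2 μ (1 : ℂ)),
    Lp.coeFn_smul (∫ y, U y ∂μ) (Lp.const 2 μ (1 : ℂ)),
    Lp.coeFn_const (p := 2) (μ := μ) (1 : ℂ), hU.coeFn_toLp,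
    (hU.sub (memLp_const (∫ y, U y ∂μ))).coeFn_toLp] with x h1 h2 h3 h4 h5
  rw [h1, h5, Pi.sub_apply, h2, Pi.smul_apply, h3, h4]
  simp

theorem complexCov_eq_inner {U V : Ω → ℂ} (hU : MemLp U 2 μ) (hV : MemLp V 2 μ) :
    complexCov μ U V = inner ℂ (centering μ hV.toLp) (centering μ hU.toLp) := by
  rw [centering_toLp, centering_toLp, ← mixedMoment_eq_inner]
  rfl

theorem complexCov_coeFn (U V : Lp ℂ 2 μ) :
    complexCov μ U V = inner ℂ (centering μ V) (centering μ U) := by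
  rw [complexCov_eq_inner (Lp.memLp U) (Lp.memLp V), Lp.toLp_coeFn, Lp.toLp_coeFn]

theorem mixedMoment_eq_complexCov_add {U V : Ω → ℂ} (hU : MemLp U 2 μ) (hV : MemLp V 2 μ) :
    mixedMoment μ U V = complexCov μ U V + (∫ x, U x ∂μ) * conj (∫ x, V x ∂μ) := by
  have hUi : Integrable U μ := hU.integrable (by norm_num)
  have hVi : Integrable V μ := hV.integrable (by norm_num)
  have hVc := memLp_conj hV
  have hUV : Integrable (fun x => U x * conj (V x)) μ := hU.integrable_mul hVc
  set a := ∫ x, U x ∂μ with ha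
  set b := ∫ x, V x ∂μ with hb
  have hVci : Integrable (fun x => conj (V x)) μ := hVc.integrable (by norm_num)
  have hbc : ∫ x, conj (V x) ∂μ = conj b := integral_conj
  have h1 : complexCov μ U V =
      ∫ x, (U x * conj (V x) - U x * conj b - a * conj (V x) + a * conj b) ∂μ := by
    refine integral_congr_ae (.of_forall fun x => ?_)
    simp only [map_sub]
    ring
  have i1 : Integrable (fun x => U x * conj b) μ := hUi.mul_const _
  have i2 : Integrable (fun x => a * conj (V x)) μ := hVci.const_mul _
  have i3 : Integrable (fun x => U x * conj (V x) - U x * conj b) μ := hUV.sub i1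
  have i4 : Integrable (fun x => U x * conj (V x) - U x * conj b - a * conj (V x)) μ := i3.sub i2
  rw [h1, integral_add i4 (integrable_const _), integral_sub i3 i2, integral_sub hUV i1,
    integral_mul_const, integral_const_mul, hbc, ← ha]
  simp [mixedMoment]

end Probability

/-! ### Self-similar processes -/

section SelfSimilar

/-- The exponents by which a self-similar sequence is renormalised to a stationary one. -/
theorem rpow_renormalise {α : ℝ} (hα : 0 < α) (H : ℝ) (m n : ℤ) :
    α ^ (-(m : ℝ) * H) * α ^ (-(n : ℝ) * H) * (α ^ m) ^ (2 * H) =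
      α ^ (-((n - m : ℤ) : ℝ) * H) := by
  rw [← Real.rpow_intCast α m, ← Real.rpow_mul hα.le, ← Real.rpow_add hα, ← Real.rpow_add hα]
  congr 1
  push_cast
  ring

/-- Renormalising a pair of sequences whose inner products scale like `α^{2mH}` under a shift by
`m` makes them jointly stationary. -/
theorem jointlyStationary_of_scaling {E : Type*} [NormedAddCommGroup E] [InnerProductSpace ℂ E]
    {α : ℝ} (hα : 0 < α) (H : ℝ) {u v : ℤ → E}
    (h : ∀ m n, inner ℂ (v m) (u n) =
      (((α ^ m) ^ (2 * H) : ℝ) : ℂ) * inner ℂ (v 0) (u (n - m))) :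
    JointlyStationary (fun k => ((α ^ (-(k : ℝ) * H) : ℝ) : ℂ) • u k)
      (fun k => ((α ^ (-(k : ℝ) * H) : ℝ) : ℂ) • v k) := by
  intro m n
  simp only [inner_smul_left, inner_smul_right, Complex.conj_ofReal]
  rw [h m n, ← rpow_renormalise hα H m n]
  push_cast
  simp
  ring

variable {Ω : Type*} [MeasurableSpace Ω] {μ : Measure Ω} [IsProbabilityMeasure μ]

/-- Second moments of two components scale like their covariances, because the means scale. -/
theorem IsMultiSelfSimilar.mixedMoment_mul {q : ℕ} {S : Set ℝ} {H : ℝ} {W : Fin q → ℝ → Ω → ℂ}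
    (hW : IsMultiSelfSimilar μ S H W) (i j : Fin q) {a t s : ℝ} (ha : 0 < a) (ht : t ∈ S)
    (hs : s ∈ S) (hat : a * t ∈ S) (has : a * s ∈ S) :
    mixedMoment μ (W i (a * t)) (W j (a * s)) =
      ((a ^ (2 * H) : ℝ) : ℂ) * mixedMoment μ (W i t) (W j s) := by
  rw [mixedMoment_eq_complexCov_add ((hW.component i).memLp _ hat) ((hW.component j).memLp _ has),
    mixedMoment_eq_complexCov_add ((hW.component i).memLp _ ht) ((hW.component j).memLp _ hs),
    hW.cross i j a ha t ht s hs hat has, (hW.component i).mean a ha t ht hat,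
    (hW.component j).mean a ha s hs has, map_mul, Complex.conj_ofReal, two_mul, Real.rpow_add ha]
  push_cast
  ring

end SelfSimilar

theorem theorem3p1 {Ω : Type*} [MeasurableSpace Ω] (μ : Measure Ω) [IsProbabilityMeasure μ]
    (q : ℕ) (α H : ℝ) (hα : 1 < α) (hH : 0 < H) (W : Fin q → ℝ → Ω → ℂ)
    (hW : IsMultiSelfSimilar μ (Set.range fun k : ℤ => α ^ k) H W) :
    ∃ φ : Fin q → OrthogonalRandomMeasure μ,
    ∃ D : Fin q → Fin q → ComplexMeasure ℝ, ∃ C : Fin q → Fin q → ComplexMeasure ℝ,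
      -- the random spectral measures live on `[0, 2π)`
      (∀ j, ∀ A : Set ℝ, MeasurableSet A → Disjoint A (Set.Ico 0 (2 * Real.pi)) → φ j A = 0) ∧
      -- harmonic-like representation
      (∀ j, ∀ k : ℤ, ∃ I : Lp ℂ 2 μ,
        (φ j).HasIntegral (fun ω => Complex.exp (Complex.I * ω * k)) I ∧
        W j (α ^ k) =ᵐ[μ] fun x => ((α ^ ((k : ℝ) * H) : ℝ) : ℂ) * I x) ∧
      -- cross spectral distributions (in particular, orthogonality on disjoint sets)
      (∀ j r, ∀ A B : Set ℝ, MeasurableSet A → MeasurableSet B →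
        mixedMoment μ (φ j A) (φ r B) = D j r (A ∩ B)) ∧
      -- spectral density
      (∀ j r, HasSpectralDensitySeries α H (fun t => mixedMoment μ (W j t) (W r 1)) (D j r)) ∧
      -- the same for centered second moments; `C = D` when `W` has mean zero
      (∀ j r, ∀ A B : Set ℝ, MeasurableSet A → MeasurableSet B →
        complexCov μ (φ j A) (φ r B) = C j r (A ∩ B)) ∧
      (∀ j r, HasSpectralDensitySeries α H (fun t => complexCov μ (W j t) (W r 1)) (C j r)) := by
  have hα0 : 0 < α := one_pos.trans hα
  have hmem (k : ℤ) : α ^ k ∈ Set.range fun k : ℤ => α ^ k := ⟨k, rfl⟩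
  have hLp (j : Fin q) (k : ℤ) : MemLp (W j (α ^ k)) 2 μ := (hW.component j).memLp _ (hmem k)
  have hsplit (m n : ℤ) : α ^ n = α ^ m * α ^ (n - m) := by
    rw [← zpow_add₀ hα0.ne']; congr 1; ring
  have hone (m : ℤ) : α ^ m = α ^ m * α ^ (0 : ℤ) := by rw [zpow_zero, mul_one]
  -- the process as a sequence in `L²(μ)`, its renormalisation, and the centered renormalisation
  let w (j : Fin q) (k : ℤ) : Lp ℂ 2 μ := (hLp j k).toLp
  let y (j : Fin q) (k : ℤ) : Lp ℂ 2 μ := ((α ^ (-(k : ℝ) * H) : ℝ) : ℂ) • w j k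
  let z (j : Fin q) (k : ℤ) : Lp ℂ 2 μ :=
    ((α ^ (-(k : ℝ) * H) : ℝ) : ℂ) • centering μ (w j k)
  have hw (j r : Fin q) (m n : ℤ) :
      inner ℂ (w r m) (w j n) = mixedMoment μ (W j (α ^ n)) (W r (α ^ m)) :=
    (mixedMoment_eq_inner (hLp j n) (hLp r m)).symm
  have hc (j r : Fin q) (m n : ℤ) : inner ℂ (centering μ (w r m)) (centering μ (w j n)) =
      complexCov μ (W j (α ^ n)) (W r (α ^ m)) :=
    (complexCov_eq_inner (hLp j n) (hLp r m)).symm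
  have hy (j r : Fin q) : JointlyStationary (y j) (y r) := by
    refine jointlyStationary_of_scaling hα0 H fun m n => ?_
    rw [hw, hw, hsplit m n]
    nth_rw 2 [hone m]
    exact hW.mixedMoment_mul j r (zpow_pos hα0 m) (hmem _) (hmem _)
      (hsplit m n ▸ hmem n) (hone m ▸ hmem m)
  have hz (j r : Fin q) : JointlyStationary (z j) (z r) := by
    refine jointlyStationary_of_scaling hα0 H fun m n => ?_
    rw [hc, hc, hsplit m n]
    nth_rw 2 [hone m]
    exact hW.cross j r _ (zpow_pos hα0 m) _ (hmem _) _ (hmem _)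
      (hsplit m n ▸ hmem n) (hone m ▸ hmem m)
  have S (j : Fin q) : SpectralRepresentation (y j) :=
    (exists_spectralRepresentation (hy j j)).some
  have T (j : Fin q) : SpectralRepresentation (z j) :=
    (exists_spectralRepresentation (hz j j)).some
  have hlp {ν : Measure ℝ} (f : Lp ℂ 2 ν) : MemLp (fun l => conj (f l)) 2 ν :=
    memLp_conj (Lp.memLp f)
  have hST (j : Fin q) {A : Set ℝ} (hA : MeasurableSet A) :
      centering μ ((S j).toVectorMeasure A) = (T j).toVectorMeasure A :=
    (S j).map_toVectorMeasure (T j) (centering μ) (fun k => map_smul _ _ _) hA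
  refine ⟨fun j => (S j).randomMeasure,
    fun j r => (S j).ν.withDensityᵥ fun l => conj ((S j).crossDensity (y r 0) l),
    fun j r => (T j).ν.withDensityᵥ fun l => conj ((T j).crossDensity (z r 0) l),
    fun j A hA hd => (S j).toVectorMeasure_eq_zero hA hd, fun j k => ?_,
    fun j r A B hA hB => ?_, fun j r => ?_, fun j r A B hA hB => ?_, fun j r => ?_⟩
  · refine ⟨y j k, ?_, ?_⟩
    · rw [← (S j).embed_trigCharLp k]
      exact (S j).hasIntegral_randomMeasure (memLp_trigChar 2 (S j).ν k)
    · filter_upwards [Lp.coeFn_smul ((α ^ (-(k : ℝ) * H) : ℝ) : ℂ) (w j k),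
        (hLp j k).coeFn_toLp] with x h1 h2
      rw [h1, Pi.smul_apply, h2, smul_eq_mul, ← mul_assoc, ← Complex.ofReal_mul,
        ← Real.rpow_add hα0]
      simp
  · rw [withDensityᵥ_apply ((hlp _).integrable (by norm_num)) (hA.inter hB),
      ← (S j).inner_toVectorMeasure (S r) (hy j r) hA hB]
    exact (OrthogonalRandomMeasure.inner_eq_mixedMoment _ _).symm
  · refine hasSpectralDensitySeries_withDensity (S j).carried (hlp _) hα0 fun n => ?_
    rw [(S j).integral_trigChar_mul_crossDensity, ← zpow_zero α, ← hw j r 0 n]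
    simp [y]
  · rw [withDensityᵥ_apply ((hlp _).integrable (by norm_num)) (hA.inter hB),
      ← (T j).inner_toVectorMeasure (T r) (hz j r) hA hB, ← hST j hA, ← hST r hB]
    exact complexCov_coeFn _ _
  · refine hasSpectralDensitySeries_withDensity (T j).carried (hlp _) hα0 fun n => ?_
    rw [(T j).integral_trigChar_mul_crossDensity, ← zpow_zero α, ← hc j r 0 n]
    simp [z]
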